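/- Consider a two-sided matching market with transferable utility, with a finite set $\mathcal L$ of $n_L$ workers and a finite set $\mathcal E$ of $n_E$ employers; let $n=n_L+n_E$. Every worker $i$ has a type $\tau(i)\in\{1,\dots,K\}$, and there is a single employer type, $1$. The value of matching worker $i$ and employer $j$ is $$\Phi(i,j)=u(\tau(i),1)+\epsilon_j^{\tau(i)}+\eta_i^{1},$$ where the $u(k,1)$ are real constants and the random variables $\epsilon_j^k$ ($j\in\mathcal E$, $1\le k\le K$) and $\eta_i^1$ ($i\in\mathcal L$) are independent and uniform on $[0,1]$. An outcome is a matching $M$ with payoffs $\gamma$ such that $\gamma_i+\gamma_j=\Phi(i,j)$ for matched pairs and unmatched agents get $0$; it is in the core if no coalition of agents can produce, by matching its members among themselves, more than the sum of their payoffs. Let $M$ be a maximum weight matching. Core solutions with matching $M$ are described by price vectors $\alpha=(\alpha_k)_k$, through $\gamma_i=u(k,1)+\eta_i^1-\alpha_k$ and $\gamma_j=\epsilon_j^k+\alpha_k$ for every matched pair $(i,j)\in M$ with $\tau(i)=k$. Let $\alpha_k^{\max}$ and $\alpha_k^{\min}$ be the largest and smallest value of $\alpha_k$ over the core, let $N(k)$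 be the number of matched workers of type $k$, and define the size of the core as $$\mathcal C=\frac{\sum_k N(k)\,|\alpha_k^{\max}-\alpha_k^{\min}|}{\sum_k N(k)}.$$ **Theorem 2.** Let $K\ge 2$ and $C>0$. There are constants $A$ and $p\in\mathbb N$, depending only on $K$ and $C$, such that the following holds. Suppose that $n_E>n_L$, let $m=n_E-n_L$, suppose that $u(k,1)\ge 0$ for all $k$, and suppose that each worker type and the employer type has at least $Cn$ agents. Then $\mathcal C$ is integrable and $$\mathrm E[\mathcal C]\le A\,\frac{(\log n)^p}{n^{1/K}\,m^{(K-1)/K}},$$ that is, $\mathrm E[\mathcal C]=O^*\big(1/(n^{1/K}m^{(K-1)/K})\big)$, where $O^*$ suppresses polylogarithmic factors. In particular, $\mathrm E[\mathcal C]=O^*(1/n)$ when $m=\Theta(n)$: for every $b>0$ there are constants $A,p$ depending only on $K,C,b$ such that $\mathrm E[\mathcal C]\le A(\log n)^p/n$ for all such markets with $m\ge bn$. -/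

import Mathlib

open MeasureTheory ProbabilityTheory

/-- Deterministic data of a two-sided market: `L` are the workers, `E` the employers, `T` and `S`
the worker and employer types. Every agent has a type and `u k q` is the type-pair utility. -/
structure Market (L E T S : Type*) where
  typeL : L → T
  typeE : E → S
  u : T → S → ℝ

section Assignment

variable {L E : Type*}

/-- A set of pairs in which no worker and no employer occurs twice. -/
def IsMatching (M : Finset (L × E)) : Prop :=
  ∀ p ∈ M, ∀ q ∈ M, p.1 = q.1 ∨ p.2 = q.2 → p = q

/-- Total value of a matching when the pair `i`, `j` is worth `Φ i j`. -/
def matchingWeight (Φ : L → E → ℝ) (M : Finset (L × E)) : ℝ :=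
  ∑ p ∈ M, Φ p.1 p.2

def IsMaxWeightMatching (Φ : L → E → ℝ) (M : Finset (L × E)) : Prop :=
  IsMatching M ∧ ∀ M' : Finset (L × E), IsMatching M' → matchingWeight Φ M' ≤ matchingWeight Φ M

/-- A matching with payoffs `x` of the workers and `y` of the employers: matched pairs share
their value, unmatched agents get nothing. -/
structure IsOutcome (Φ : L → E → ℝ) (M : Finset (L × E)) (x : L → ℝ) (y : E → ℝ) : Prop where
  matching : IsMatching M
  matched : ∀ i j, (i, j) ∈ M → x i + y j = Φ i j
  unmatchedL : ∀ i, (∀ j, (i, j) ∉ M) → x i = 0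
  unmatchedE : ∀ j, (∀ i, (i, j) ∉ M) → y j = 0

/-- An outcome is in the core if no coalition (workers `A` and employers `B`) can, by matching
its members among themselves, produce more than the sum of their payoffs. -/
def InCore (Φ : L → E → ℝ) (M : Finset (L × E)) (x : L → ℝ) (y : E → ℝ) : Prop :=
  IsOutcome Φ M x y ∧
    ∀ (A : Finset L) (B : Finset E) (M' : Finset (L × E)), IsMatching M' → M' ⊆ A ×ˢ B →
      matchingWeight Φ M' ≤ ∑ i ∈ A, x i + ∑ j ∈ B, y j

end Assignment

namespace Market

variable {L E T S : Type*}

/-- The value of the pair `i`, `j`: `u (τ i) (τ j) + ε_j^{τ i} + η_i^{τ j}`. -/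
def value (mk : Market L E T S) (ε : E → T → ℝ) (η : L → S → ℝ) (i : L) (j : E) : ℝ :=
  mk.u (mk.typeL i) (mk.typeE j) + ε j (mk.typeL i) + η i (mk.typeE j)

/-- `α` is a vector of type-pair prices of a core solution with matching `M`: it gives the payoffs
`u k q + η_i^q - α k q` and `ε_j^k + α k q` of all matched `i` (of type `k`) and `j` (of type `q`). -/
def IsCorePrice (mk : Market L E T S) (ε : E → T → ℝ) (η : L → S → ℝ) (M : Finset (L × E))
    (α : T → S → ℝ) : Prop :=
  ∃ (x : L → ℝ) (y : E → ℝ), InCore (mk.value ε η) M x y ∧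
    ∀ i j, (i, j) ∈ M →
      x i = mk.u (mk.typeL i) (mk.typeE j) + η i (mk.typeE j) - α (mk.typeL i) (mk.typeE j) ∧
      y j = ε j (mk.typeL i) + α (mk.typeL i) (mk.typeE j)

/-- The largest price of the type pair `k`, `q` over the core. -/
noncomputable def alphaMax (mk : Market L E T S) (ε : E → T → ℝ) (η : L → S → ℝ)
    (M : Finset (L × E)) (k : T) (q : S) : ℝ :=
  sSup {a | ∃ α, mk.IsCorePrice ε η M α ∧ α k q = a}

/-- The smallest price of the type pair `k`, `q` over the core. -/
noncomputable def alphaMin (mk : Market L E T S) (ε : E → T → ℝ) (η : L → S → ℝ)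
    (M : Finset (L × E)) (k : T) (q : S) : ℝ :=
  sInf {a | ∃ α, mk.IsCorePrice ε η M α ∧ α k q = a}

/-- Number of pairs in `M` between agents of types `k` and `q`. -/
def numMatches [DecidableEq T] [DecidableEq S] (mk : Market L E T S) (M : Finset (L × E))
    (k : T) (q : S) : ℕ :=
  (M.filter fun p => mk.typeL p.1 = k ∧ mk.typeE p.2 = q).card

/-- The size of the core. A type pair without matches has an unconstrained price, but enters with
weight zero. -/
noncomputable def coreSize [Fintype T] [Fintype S] [DecidableEq T] [DecidableEq S]
    (mk : Market L E T S) (ε : E → T → ℝ) (η : L → S → ℝ) (M : Finset (L × E)) : ℝ :=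
  (∑ k, ∑ q, (mk.numMatches M k q : ℝ) * |mk.alphaMax ε η M k q - mk.alphaMin ε η M k q|) /
    ∑ k, ∑ q, (mk.numMatches M k q : ℝ)

/-- Every type, on either side, has at least `c * n` agents, `n` being the number of all agents. -/
def TypesAtLeast [Fintype L] [Fintype E] [DecidableEq T] [DecidableEq S]
    (mk : Market L E T S) (c : ℝ) : Prop :=
  (∀ k : T, c * (Fintype.card L + Fintype.card E : ℕ) ≤
    ((Finset.univ.filter fun i => mk.typeL i = k).card : ℝ)) ∧
  (∀ q : S, c * (Fintype.card L + Fintype.card E : ℕ) ≤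
    ((Finset.univ.filter fun j => mk.typeE j = q).card : ℝ))

end Market

/-- The productivities `ε_j^k` and `η_i^q` are, all together, independent and uniform on `[0,1]`. -/
structure IsUniformShocks {L E T S Ω : Type*} [MeasurableSpace Ω] (P : Measure Ω)
    (ε : E → T → Ω → ℝ) (η : L → S → Ω → ℝ) : Prop where
  measurable_ε : ∀ j k, Measurable (ε j k)
  measurable_η : ∀ i q, Measurable (η i q)
  uniform_ε : ∀ j k, pdf.IsUniform (ε j k) (Set.Icc 0 1) P volume
  uniform_η : ∀ i q, pdf.IsUniform (η i q) (Set.Icc 0 1) P volume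
  indep : iIndepFun (Sum.elim (fun p : E × T => ε p.1 p.2) (fun p : L × S => η p.1 p.2)) P

/-! Write `p = -α`. Almost surely all pair values are positive, and employers outnumber workers, so
every worker is matched. Core prices are then exactly the `p` that support the matching
competitively: an employer, seen as the point `ε j` of the unit cube, takes a type that is best for
it at prices `p`, or nothing. Core payoffs fit every maximum weight matching, so the set of these
`p` depends on `ε` alone, and the core size is almost surely the weighted mean `meanGap` of its
coordinate widths.

Two supporting vectors `p`, `p'` support a common matching, so no sample point can have strictly
different demands under them: the regions of such points are empty. This is used twice. If `p k - p'
k` exceeds `p l - p' l`, the points that leave `k` for `l` contain a diagonal strip of about that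
width; its length is bounded below because worker types of linear size keep prices away from 1.
Hence all coordinates change together up to `O(log n / n)` (`Supports.sub_sub_sub_le`). Next, the
box of points with `k`-coordinate between `p' k` and `p k` and the others below `p` is empty, so `(p
k - p' k) * ∏_{i ≠ k} p i = O(log n / n)` (`Supports.sub_mul_prod_le`). For the cheapest type `k`
that product is at least `V ^ ((K-1)/K)`, where `V = ∏ p i`.

Finally `V` cannot be small, since the unmatched employers, at least `m` of them, lie below `p`: `m
/ V` is at most `recipVolume`, whose mean is `n_E` times a power of a logarithm
(`Supports.mul_inv_prod_le`, `integral_recipVolume`). The gap is thus of order `1/n + (1/n) (n/m) ^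
((K-1)/K)` up to logarithms, and the second term is the claimed rate. -/

/-! ### Core payoffs and maximum weight matchings. -/

section Matching

variable {L E T : Type*}

/-- Every worker is matched. -/
def Saturates (M : Finset (L × E)) : Prop := ∀ i, ∃ j, (i, j) ∈ M

/-- The prices `p` of the worker types support the matching `M`: every matched employer prefers
the type it gets, no unmatched employer gains from any type. -/
structure Supports (τ : L → T) (M : Finset (L × E)) (ε : E → T → ℝ) (p : T → ℝ) : Prop where
  best : ∀ i j, (i, j) ∈ M → ∀ l, ε j l - p l ≤ ε j (τ i) - p (τ i)
  nonneg : ∀ i j, (i, j) ∈ M → p (τ i) ≤ ε j (τ i)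
  unmatched : ∀ j, (∀ i, (i, j) ∉ M) → ∀ l, ε j l ≤ p l

theorem IsMatching.fst_injOn {M : Finset (L × E)} (hM : IsMatching M) :
    Set.InjOn Prod.fst (M : Set (L × E)) := fun p hp q hq h => hM p hp q hq (Or.inl h)

theorem IsMatching.snd_injOn {M : Finset (L × E)} (hM : IsMatching M) :
    Set.InjOn Prod.snd (M : Set (L × E)) := fun p hp q hq h => hM p hp q hq (Or.inr h)

theorem IsMatching.sum_le {M : Finset (L × E)} (hM : IsMatching M) {A : Finset L} {B : Finset E}
    (hAB : M ⊆ A ×ˢ B) {x : L → ℝ} {y : E → ℝ} (hx : ∀ i, 0 ≤ x i) (hy : ∀ j, 0 ≤ y j) :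
    ∑ q ∈ M, (x q.1 + y q.2) ≤ ∑ i ∈ A, x i + ∑ j ∈ B, y j := by
  classical
  rw [Finset.sum_add_distrib, ← Finset.sum_image (f := x) hM.fst_injOn,
    ← Finset.sum_image (f := y) hM.snd_injOn]
  refine add_le_add (Finset.sum_le_sum_of_subset_of_nonneg ?_ fun i _ _ => hx i)
    (Finset.sum_le_sum_of_subset_of_nonneg ?_ fun i _ _ => hy i)
  · intro i hi
    obtain ⟨q, hq, rfl⟩ := Finset.mem_image.1 hi
    exact (Finset.mem_product.1 (hAB hq)).1
  · intro i hi
    obtain ⟨q, hq, rfl⟩ := Finset.mem_image.1 hi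
    exact (Finset.mem_product.1 (hAB hq)).2

theorem IsMatching.singleton (i : L) (j : E) : IsMatching {(i, j)} := by
  intro p hp q hq _
  rw [Finset.mem_singleton.1 hp, Finset.mem_singleton.1 hq]

theorem IsMatching.empty : IsMatching (∅ : Finset (L × E)) := by
  intro p hp; simp at hp

variable {Φ : L → E → ℝ} {M M' : Finset (L × E)} {x : L → ℝ} {y : E → ℝ}

theorem InCore.nonneg_left (h : InCore Φ M x y) (i : L) : 0 ≤ x i := by
  simpa [matchingWeight] using h.2 {i} ∅ ∅ IsMatching.empty (by simp)

theorem InCore.nonneg_right (h : InCore Φ M x y) (j : E) : 0 ≤ y j := by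
  simpa [matchingWeight] using h.2 ∅ {j} ∅ IsMatching.empty (by simp)

theorem InCore.le_add (h : InCore Φ M x y) (i : L) (j : E) : Φ i j ≤ x i + y j := by
  simpa [matchingWeight] using h.2 {i} {j} {(i, j)} (IsMatching.singleton i j) (by simp)

theorem inCore_of_le (hout : IsOutcome Φ M x y) (hx : ∀ i, 0 ≤ x i) (hy : ∀ j, 0 ≤ y j)
    (hxy : ∀ i j, Φ i j ≤ x i + y j) : InCore Φ M x y := by
  refine ⟨hout, fun A B M' hM' hAB => le_trans ?_ (hM'.sum_le hAB hx hy)⟩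
  exact Finset.sum_le_sum fun q _ => hxy _ _

variable [Fintype L] [Fintype E]

theorem IsOutcome.weight_eq (h : IsOutcome Φ M x y) :
    matchingWeight Φ M = ∑ i, x i + ∑ j, y j := by
  classical
  have h1 : matchingWeight Φ M = ∑ q ∈ M, (x q.1 + y q.2) :=
    Finset.sum_congr rfl fun q hq => (h.matched q.1 q.2 hq).symm
  rw [h1, Finset.sum_add_distrib, ← Finset.sum_image (f := x) h.matching.fst_injOn,
    ← Finset.sum_image (f := y) h.matching.snd_injOn]
  congr 1
  · refine Finset.sum_subset (Finset.subset_univ _) fun i _ hi => h.unmatchedL i fun j hj => hi ?_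
    exact Finset.mem_image.2 ⟨(i, j), hj, rfl⟩
  · refine Finset.sum_subset (Finset.subset_univ _) fun j _ hj => h.unmatchedE j fun i hi => hj ?_
    exact Finset.mem_image.2 ⟨(i, j), hi, rfl⟩

/-- Core payoffs are compatible with every maximum weight matching. -/
theorem InCore.of_isMaxWeightMatching (h : InCore Φ M x y) (hM' : IsMaxWeightMatching Φ M') :
    InCore Φ M' x y := by
  classical
  have hx := h.nonneg_left
  have hy := h.nonneg_right
  -- Complementary slackness: with this inequality the payoffs of the agents unmatched in `M'` and
  -- the slacks of its pairs, all nonnegative, have total at most zero, so each vanishes.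
  have hw : ∑ i, x i + ∑ j, y j ≤ matchingWeight Φ M' :=
    h.1.weight_eq ▸ hM'.2 M h.1.matching
  have hI := Finset.sum_image (f := x) hM'.1.fst_injOn
  have hJ := Finset.sum_image (f := y) hM'.1.snd_injOn
  have hI' := Finset.sum_add_sum_compl (M'.image Prod.fst) x
  have hJ' := Finset.sum_add_sum_compl (M'.image Prod.snd) y
  have hI0 : ∀ i ∈ (M'.image Prod.fst)ᶜ, 0 ≤ x i := fun i _ => hx i
  have hJ0 : ∀ j ∈ (M'.image Prod.snd)ᶜ, 0 ≤ y j := fun j _ => hy j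
  have hI1 := Finset.sum_nonneg hI0
  have hJ1 := Finset.sum_nonneg hJ0
  have hP0 : ∀ q ∈ M', 0 ≤ x q.1 + y q.2 - Φ q.1 q.2 := fun q _ => by
    linarith [h.le_add q.1 q.2]
  have hP1 := Finset.sum_nonneg hP0
  have hP2 : ∑ q ∈ M', (x q.1 + y q.2 - Φ q.1 q.2) =
      ∑ q ∈ M', x q.1 + ∑ q ∈ M', y q.2 - matchingWeight Φ M' := by
    rw [Finset.sum_sub_distrib, Finset.sum_add_distrib]; rfl
  have eI := (Finset.sum_eq_zero_iff_of_nonneg hI0).1 (by linarith)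
  have eJ := (Finset.sum_eq_zero_iff_of_nonneg hJ0).1 (by linarith)
  have eP := (Finset.sum_eq_zero_iff_of_nonneg hP0).1 (by linarith)
  refine inCore_of_le ⟨hM'.1, fun i j hij => ?_, fun i hi => eI i ?_, fun j hj => eJ j ?_⟩
    hx hy h.le_add
  · have := eP _ hij
    simp only at this
    linarith
  · simpa using hi
  · simpa using hj

/-- An unmatched worker could be joined to an employer left free by counting, at a strict gain. -/
theorem IsMaxWeightMatching.saturates (hM : IsMaxWeightMatching Φ M) (hΦ : ∀ i j, 0 < Φ i j)
    (hcard : Fintype.card L < Fintype.card E) : Saturates M := by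
  classical
  intro i
  by_contra! hi
  obtain ⟨j, hj⟩ : ∃ j, j ∉ M.image Prod.snd := by
    by_contra! hj
    have h1 : (M.image Prod.snd).card = M.card := Finset.card_image_of_injOn hM.1.snd_injOn
    have h2 : (M.image Prod.fst).card = M.card := Finset.card_image_of_injOn hM.1.fst_injOn
    have h3 : M.image Prod.snd = Finset.univ := Finset.eq_univ_of_forall hj
    rw [h3, Finset.card_univ] at h1
    have := Finset.card_le_univ (M.image Prod.fst)
    omega
  have hj' : ∀ i, (i, j) ∉ M := fun i hi => hj (Finset.mem_image.2 ⟨_, hi, rfl⟩)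
  have hmat : IsMatching (insert (i, j) M) := by
    intro p hp q hq hpq
    rcases Finset.mem_insert.1 hp with rfl | hp' <;> rcases Finset.mem_insert.1 hq with rfl | hq'
    · rfl
    · obtain ⟨a, b⟩ := q
      rcases hpq with h | h <;> simp only at h <;> subst h
      · exact absurd hq' (hi _)
      · exact absurd hq' (hj' _)
    · obtain ⟨a, b⟩ := p
      rcases hpq with h | h <;> simp only at h <;> subst h
      · exact absurd hp' (hi _)
      · exact absurd hp' (hj' _)
    · exact hM.1 p hp' q hq' hpq
  have := hM.2 _ hmat
  rw [matchingWeight, Finset.sum_insert (hi j)] at this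
  have := hΦ i j
  simp only [matchingWeight] at *
  linarith

end Matching

/-! ### Core prices as supporting prices. -/

namespace Market

variable {L E T : Type*} {mk : Market L E T (Fin 1)} {ε : E → T → ℝ} {η : L → Fin 1 → ℝ}
  {M : Finset (L × E)}

theorem value_eq (mk : Market L E T (Fin 1)) (ε : E → T → ℝ) (η : L → Fin 1 → ℝ) (i : L) (j : E) :
    mk.value ε η i j = mk.u (mk.typeL i) 0 + ε j (mk.typeL i) + η i 0 := by
  simp [value, Subsingleton.elim (mk.typeE j) 0]

/-- Each type has a matched worker, whose payoff reveals the price of the type. Stability of the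
pair formed by this worker and an arbitrary employer `j` bounds `y j` below by what `j` would earn
from that type. -/
theorem IsCorePrice.supports {α : T → Fin 1 → ℝ} (h : mk.IsCorePrice ε η M α)
    (hM : Saturates M) (hτ : Function.Surjective mk.typeL) :
    Supports mk.typeL M ε fun k => -α k 0 := by
  obtain ⟨x, y, hc, hxy⟩ := h
  simp only [fun j => Subsingleton.elim (mk.typeE j) 0] at hxy
  have key : ∀ j l, ε j l + α l 0 ≤ y j := by
    intro j l
    obtain ⟨i, rfl⟩ := hτ l
    obtain ⟨j', hj'⟩ := hM i
    have h1 := (hxy i j' hj').1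
    have h2 := hc.le_add i j
    rw [value_eq] at h2
    linarith
  refine ⟨fun i j hij l => ?_, fun i j hij => ?_, fun j hj l => ?_⟩
  · have := key j l
    have := (hxy i j hij).2
    linarith
  · have := hc.nonneg_right j
    have := (hxy i j hij).2
    linarith
  · have := key j l
    have := hc.1.unmatchedE j hj
    linarith

/-- Employers receive their surplus at the prices, workers `u + η + p`. The sign conditions on `u`,
`η`, `p` make the worker payoffs nonnegative; optimality of the employers' choices excludes blocking
pairs. -/
theorem isCorePrice_of_supports {p : T → ℝ} (hp : Supports mk.typeL M ε p) (hm : IsMatching M)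
    (hM : Saturates M) (hp0 : ∀ k, 0 ≤ p k) (hη : ∀ i, 0 ≤ η i 0) (hu : ∀ k, 0 ≤ mk.u k 0) :
    mk.IsCorePrice ε η M fun k _ => -p k := by
  classical
  have hy : ∀ j, ∃ y : ℝ, (∀ i, (i, j) ∈ M → y = ε j (mk.typeL i) - p (mk.typeL i)) ∧
      ((∀ i, (i, j) ∉ M) → y = 0) := by
    intro j
    by_cases h : ∃ i, (i, j) ∈ M
    · obtain ⟨i, hi⟩ := h
      refine ⟨ε j (mk.typeL i) - p (mk.typeL i), fun i' hi' => ?_, fun h => absurd hi (h i)⟩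
      have := hm _ hi _ hi' (Or.inr rfl)
      simp only [Prod.mk.injEq, and_true] at this
      rw [this]
    · push Not at h
      exact ⟨0, fun i hi => absurd hi (h i), fun _ => rfl⟩
  choose y hy1 hy2 using hy
  refine ⟨fun i => mk.u (mk.typeL i) 0 + η i 0 + p (mk.typeL i), y, inCore_of_le ⟨hm, ?_, ?_, hy2⟩
    ?_ ?_ ?_, ?_⟩
  · intro i j hij
    rw [value_eq, hy1 j i hij]
    ring
  · intro i hi
    obtain ⟨j, hj⟩ := hM i
    exact absurd hj (hi j)
  · intro i
    have := hp0 (mk.typeL i)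
    have := hη i
    have := hu (mk.typeL i)
    linarith
  · intro j
    by_cases h : ∃ i, (i, j) ∈ M
    · obtain ⟨i, hi⟩ := h
      rw [hy1 j i hi]
      linarith [hp.nonneg i j hi]
    · push Not at h
      rw [hy2 j h]
  · intro i j
    rw [value_eq]
    have : ε j (mk.typeL i) - p (mk.typeL i) ≤ y j := by
      by_cases h : ∃ i, (i, j) ∈ M
      · obtain ⟨i', hi⟩ := h
        rw [hy1 j i' hi]
        exact hp.best i' j hi _
      · push Not at h
        rw [hy2 j h]
        linarith [hp.unmatched j h (mk.typeL i)]
    linarith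
  · intro i j hij
    simp only [fun j => Subsingleton.elim (mk.typeE j) 0]
    refine ⟨by ring, ?_⟩
    rw [hy1 j i hij]
    ring

/-- The prices of the core do not depend on the maximum weight matching. -/
theorem IsCorePrice.of_isMaxWeightMatching [Fintype L] [Fintype E] {M' : Finset (L × E)}
    {α : T → Fin 1 → ℝ} (h : mk.IsCorePrice ε η M α) (hM : Saturates M)
    (hM' : IsMaxWeightMatching (mk.value ε η) M') : mk.IsCorePrice ε η M' α := by
  obtain ⟨x, y, hc, hxy⟩ := h
  simp only [fun j => Subsingleton.elim (mk.typeE j) 0] at hxy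
  have hc' := hc.of_isMaxWeightMatching hM'
  refine ⟨x, y, hc', fun i j hij => ?_⟩
  simp only [fun j => Subsingleton.elim (mk.typeE j) 0]
  obtain ⟨j', hj'⟩ := hM i
  have h1 := (hxy i j' hj').1
  have h2 := hc'.1.matched i j hij
  rw [value_eq] at h2
  exact ⟨h1, by linarith⟩

end Market

/-! ### Comparison of two price vectors supporting one matching. -/

section Prices

variable {L E T : Type*} {τ : L → T} {M : Finset (L × E)} {ε : E → T → ℝ} {p p' : T → ℝ}

theorem Supports.price_le_one (h : Supports τ M ε p) (hM : Saturates M)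
    (hτ : Function.Surjective τ) (hε : ∀ j k, ε j k ≤ 1) (k : T) : p k ≤ 1 := by
  obtain ⟨i, rfl⟩ := hτ k
  obtain ⟨j, hj⟩ := hM i
  exact (h.nonneg i j hj).trans (hε j _)

/-- No employer may strictly prefer `k` at the prices `p'` and strictly prefer `l` to `k` at the
prices `p`, if both support the same matching. -/
theorem Supports.not_strict (h : Supports τ M ε p) (h' : Supports τ M ε p') {j : E} {k l : T}
    (hk : ∀ i, i ≠ k → ε j i - p' i < ε j k - p' k) (hpos : p' k < ε j k)
    (hl : ε j k - p k < ε j l - p l) : False := by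
  by_cases hj : ∃ i, (i, j) ∈ M
  · obtain ⟨i, hi⟩ := hj
    have hik : τ i = k := by
      by_contra hne
      exact absurd (h'.best i j hi k) (not_le.2 (hk _ hne))
    have := h.best i j hi l
    rw [hik] at this
    linarith
  · push Not at hj
    linarith [h'.unmatched j hj k]

/-- Gaining from `k` at `p'` forces `j` to be matched, losing from every type at `p` forces it to be
unmatched. -/
theorem Supports.not_between (h : Supports τ M ε p) (h' : Supports τ M ε p') {j : E} {k : T}
    (hk : p' k < ε j k) (hl : ∀ l, ε j l < p l) : False := by
  by_cases hj : ∃ i, (i, j) ∈ M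
  · obtain ⟨i, hi⟩ := hj
    linarith [h.nonneg i j hi, hl (τ i)]
  · push Not at hj
    linarith [h'.unmatched j hj k]

variable [Fintype L] [Fintype E]

open Classical in
theorem IsMatching.card_unmatched (hM : IsMatching M) :
    Fintype.card E - Fintype.card L ≤
      (Finset.univ.filter fun j : E => ∀ i : L, (i, j) ∉ M).card := by
  have h1 : (Finset.univ.filter fun j : E => ∀ i : L, (i, j) ∉ M) = (M.image Prod.snd)ᶜ := by
    ext j; simp
  have h2 : (M.image Prod.snd).card = M.card := Finset.card_image_of_injOn hM.snd_injOn
  have h3 : (M.image Prod.fst).card = M.card := Finset.card_image_of_injOn hM.fst_injOn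
  have := Finset.card_le_univ (M.image Prod.fst)
  rw [h1, Finset.card_compl]
  omega

/-- Some employer is unmatched, and its nonnegative productivities lie below the prices. -/
theorem Supports.price_nonneg (h : Supports τ M ε p) (hM : IsMatching M)
    (hcard : Fintype.card L < Fintype.card E) (hε : ∀ j k, 0 ≤ ε j k) (k : T) : 0 ≤ p k := by
  classical
  have := hM.card_unmatched
  obtain ⟨j, hj⟩ := Finset.card_pos.1 (lt_of_lt_of_le (by omega) this)
  exact (hε j k).trans (h.unmatched j (Finset.mem_filter.1 hj).2 k)

/-- All workers of type `k` are matched to employers whose `ε j k` is at least the price. -/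
theorem Supports.card_le [DecidableEq T] (h : Supports τ M ε p) (hm : IsMatching M) (hM : Saturates M) (k : T) :
    (Finset.univ.filter fun i => τ i = k).card ≤
      (Finset.univ.filter fun j => p k ≤ ε j k).card := by
  choose f hf using hM
  refine Finset.card_le_card_of_injOn f (fun i hi => ?_) fun i _ i' _ hii => ?_
  · simp only [Finset.coe_filter, Finset.mem_univ, true_and, Set.mem_ofPred_eq] at hi ⊢
    have := h.nonneg i (f i) (hf i)
    rwa [hi] at this
  · have := hm _ (hf i) _ (hf i') (Or.inr hii)
    simp only [Prod.mk.injEq] at this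
    exact this.1

end Prices

/-! ### Measurability of extrema over compact fibres. -/

section Measurability

variable {X Y : Type*} [TopologicalSpace X] [MeasurableSpace X] [OpensMeasurableSpace X]
  [TopologicalSpace Y] [CompactSpace Y] {C : Set (X × Y)} {f : Y → ℝ}

/-- The supremum is attained on nonempty fibres, so superlevel sets are projections of closed sets
along a compact factor, hence closed. Empty fibres have supremum `0` and contribute the complement
of the projection when `t ≤ 0`. -/
theorem measurable_sSup_image_section (hC : IsClosed C) (hf : Continuous f) :
    Measurable fun x => sSup (f '' {y | (x, y) ∈ C}) := by
  have hfib : ∀ x, IsCompact {y | (x, y) ∈ C} := fun x =>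
    (hC.preimage (Continuous.prodMk_right x)).isCompact
  have hproj : ∀ D : Set (X × Y), IsClosed D → MeasurableSet (Prod.fst '' D) := fun D hD =>
    (isClosedMap_fst_of_compactSpace D hD).measurableSet
  refine measurable_of_Ici fun t => ?_
  have : (fun x => sSup (f '' {y | (x, y) ∈ C})) ⁻¹' Set.Ici t =
      Prod.fst '' (C ∩ {q | t ≤ f q.2}) ∪ ((Prod.fst '' C)ᶜ ∩ {_x | t ≤ 0}) := by
    ext x
    simp only [Set.mem_preimage, Set.mem_Ici, Set.mem_union, Set.mem_inter_iff, Set.mem_compl_iff]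
    rcases Set.eq_empty_or_nonempty {y | (x, y) ∈ C} with h | h
    · have h1 : ∀ y, (x, y) ∉ C := fun y hy => (Set.ext_iff.1 h y).1 hy
      have h2 : x ∉ Prod.fst '' C := by
        rintro ⟨⟨a, b⟩, hab, rfl⟩
        exact h1 _ hab
      have h3 : x ∉ Prod.fst '' (C ∩ {q | t ≤ f q.2}) := by
        rintro ⟨⟨a, b⟩, hab, rfl⟩
        exact h1 _ hab.1
      rw [h]
      simp only [Set.image_empty, Real.sSup_empty, h3, h2, false_or, not_false_eq_true, true_and]
      rfl
    · have h2 : x ∈ Prod.fst '' C := by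
        obtain ⟨y, hy⟩ := h
        exact ⟨(x, y), hy, rfl⟩
      simp only [h2, not_true_eq_false, false_and, or_false]
      constructor
      · intro ht
        obtain ⟨y, hy, hy'⟩ := ((hfib x).image hf).sSup_mem (h.image f)
        exact ⟨(x, y), ⟨hy, by rw [← hy'] at ht; exact ht⟩, rfl⟩
      · rintro ⟨⟨a, b⟩, hab, rfl⟩
        exact le_trans hab.2 (le_csSup ((hfib a).image hf).bddAbove ⟨b, hab.1, rfl⟩)
  rw [this]
  exact (hproj _ (hC.inter (isClosed_le continuous_const (hf.comp continuous_snd)))).union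
    ((hproj _ hC).compl.inter (MeasurableSet.const _))

theorem measurable_sInf_image_section (hC : IsClosed C) (hf : Continuous f) :
    Measurable fun x => sInf (f '' {y | (x, y) ∈ C}) := by
  have h := (measurable_sSup_image_section hC hf.neg).neg
  convert h using 2 with x
  rw [Pi.neg_apply, Real.sInf_def, ← Set.image_neg_eq_neg, Set.image_image]
  rfl

end Measurability

theorem abs_sSup_sub_sInf_le {S : Set ℝ} {D : ℝ} (hD : 0 ≤ D)
    (h : ∀ a ∈ S, ∀ b ∈ S, a - b ≤ D) : |sSup S - sInf S| ≤ D := by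
  rcases S.eq_empty_or_nonempty with rfl | ⟨c, hc⟩
  · simpa using hD
  have h1 : ∀ b ∈ S, sSup S ≤ D + b := fun b hb => csSup_le ⟨c, hc⟩ fun a ha => by
    linarith [h a ha b hb]
  have h2 : sSup S - D ≤ sInf S := le_csInf ⟨c, hc⟩ fun b hb => by linarith [h1 b hb]
  have h3 : sInf S ≤ sSup S := Real.sInf_le_sSup S
    ⟨c - D, fun b hb => by linarith [h c hc b hb]⟩ ⟨D + c, fun a ha => by linarith [h a ha c hc]⟩
  rw [abs_of_nonneg (by linarith)]
  linarith

/-! ### The set of supporting prices and its widths. -/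

section PriceSet

variable {L E T : Type*}

/-- The price vectors in the unit cube that support some matching of all workers. -/
def priceSet (τ : L → T) (ε : E → T → ℝ) : Set (T → unitInterval) :=
  {p | ∃ M : Finset (L × E), IsMatching M ∧ Saturates M ∧ Supports τ M ε fun k => (p k : ℝ)}

/-- There are finitely many matchings, and for each of them support is a system of weak
inequalities, jointly continuous in shocks and prices. -/
theorem isClosed_priceSet [Finite L] [Finite E] (τ : L → T) :
    IsClosed {q : (E → T → ℝ) × (T → unitInterval) | q.2 ∈ priceSet τ q.1} := by
  have : {q : (E → T → ℝ) × (T → unitInterval) | q.2 ∈ priceSet τ q.1} =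
      ⋃ M : {M : Finset (L × E) // IsMatching M ∧ Saturates M},
        {q | Supports τ M.1 q.1 fun k => (q.2 k : ℝ)} := by
    ext q
    simp only [priceSet, Set.mem_ofPred_eq, Set.mem_iUnion, Subtype.exists, exists_prop, and_assoc]
  rw [this]
  refine isClosed_iUnion_of_finite fun M => ?_
  have : {q : (E → T → ℝ) × (T → unitInterval) | Supports τ M.1 q.1 fun k => (q.2 k : ℝ)} =
      (⋂ (i) (j) (_ : (i, j) ∈ M.1) (l),
        {q | q.1 j l - (q.2 l : ℝ) ≤ q.1 j (τ i) - (q.2 (τ i) : ℝ)}) ∩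
      (⋂ (i) (j) (_ : (i, j) ∈ M.1), {q | (q.2 (τ i) : ℝ) ≤ q.1 j (τ i)}) ∩
      ⋂ (j) (_ : ∀ i, (i, j) ∉ M.1) (l), {q | q.1 j l ≤ (q.2 l : ℝ)} := by
    ext q
    simp only [Set.mem_ofPred_eq, Set.mem_inter_iff, Set.mem_iInter]
    exact ⟨fun h => ⟨⟨h.best, h.nonneg⟩, h.unmatched⟩, fun h => ⟨h.1.1, h.1.2, h.2⟩⟩
  rw [this]
  refine (IsClosed.inter ?_ ?_).inter ?_
  · refine isClosed_iInter fun i => isClosed_iInter fun j => isClosed_iInter fun _ =>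
      isClosed_iInter fun l => isClosed_le (by fun_prop) (by fun_prop)
  · refine isClosed_iInter fun i => isClosed_iInter fun j => isClosed_iInter fun _ =>
      isClosed_le (by fun_prop) (by fun_prop)
  · refine isClosed_iInter fun j => isClosed_iInter fun _ => isClosed_iInter fun l =>
      isClosed_le (by fun_prop) (by fun_prop)

/-- The diameter of the set of negated prices of type `k`. -/
noncomputable def priceGap (τ : L → T) (ε : E → T → ℝ) (k : T) : ℝ :=
  |sSup ((fun p : T → unitInterval => -(p k : ℝ)) '' priceSet τ ε) -
    sInf ((fun p : T → unitInterval => -(p k : ℝ)) '' priceSet τ ε)|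

theorem measurable_priceGap [Finite L] [Finite E] [Countable T] (τ : L → T) (k : T) :
    Measurable fun ε : E → T → ℝ => priceGap τ ε k := by
  have hf : Continuous fun p : T → unitInterval => -(p k : ℝ) := by fun_prop
  have : Countable E := Finite.to_countable
  exact ((measurable_sSup_image_section (isClosed_priceSet τ) hf).sub
    (measurable_sInf_image_section (isClosed_priceSet τ) hf)).abs

theorem priceGap_nonneg (τ : L → T) (ε : E → T → ℝ) (k : T) : 0 ≤ priceGap τ ε k := abs_nonneg _

theorem priceGap_le {τ : L → T} {ε : E → T → ℝ} {k : T} {D : ℝ} (hD : 0 ≤ D)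
    (h : ∀ p ∈ priceSet τ ε, ∀ p' ∈ priceSet τ ε, (p k : ℝ) - p' k ≤ D) : priceGap τ ε k ≤ D := by
  refine abs_sSup_sub_sInf_le hD ?_
  rintro _ ⟨p, hp, rfl⟩ _ ⟨p', hp', rfl⟩
  have := h p' hp' p hp
  simp only
  linarith

theorem priceGap_le_one (τ : L → T) (ε : E → T → ℝ) (k : T) : priceGap τ ε k ≤ 1 :=
  priceGap_le zero_le_one fun p _ p' _ => by
    have := (p k).2.2
    have := (p' k).2.1
    linarith

/-- The average of the price gaps, weighted by the sizes of the worker types. -/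
noncomputable def meanGap [Fintype L] [Fintype T] [DecidableEq T] (τ : L → T) (ε : E → T → ℝ) : ℝ :=
  (∑ k, ((Finset.univ.filter fun i => τ i = k).card : ℝ) * priceGap τ ε k) /
    ∑ k, ((Finset.univ.filter fun i => τ i = k).card : ℝ)

theorem measurable_meanGap [Fintype L] [Finite E] [Fintype T] [DecidableEq T] (τ : L → T) :
    Measurable fun ε : E → T → ℝ => meanGap τ ε :=
  (Finset.measurable_sum _ fun k _ => (measurable_priceGap τ k).const_mul _).div_const _

theorem meanGap_nonneg [Fintype L] [Fintype T] [DecidableEq T] (τ : L → T) (ε : E → T → ℝ) : 0 ≤ meanGap τ ε :=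
  div_nonneg (Finset.sum_nonneg fun k _ => mul_nonneg (Nat.cast_nonneg _) (priceGap_nonneg τ ε k))
    (Finset.sum_nonneg fun _ _ => Nat.cast_nonneg _)

theorem meanGap_le [Fintype L] [Fintype T] [DecidableEq T] {τ : L → T} {ε : E → T → ℝ} {D : ℝ} (hD : 0 ≤ D)
    (h : ∀ k, priceGap τ ε k ≤ D) : meanGap τ ε ≤ D := by
  refine div_le_of_le_mul₀ (Finset.sum_nonneg fun _ _ => Nat.cast_nonneg _) hD ?_
  rw [Finset.mul_sum]
  refine Finset.sum_le_sum fun k _ => ?_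
  rw [mul_comm]
  exact mul_le_mul_of_nonneg_right (h k) (Nat.cast_nonneg _)

end PriceSet

/-! ### The core size as a function of `ε`. -/

namespace Market

variable {L E T : Type*} [Fintype L] {mk : Market L E T (Fin 1)} {ε : E → T → ℝ}
  {η : L → Fin 1 → ℝ} {M : Finset (L × E)}

theorem numMatches_eq [DecidableEq T] (hm : IsMatching M) (hM : Saturates M) (k : T) :
    mk.numMatches M k 0 = (Finset.univ.filter fun i => mk.typeL i = k).card := by
  choose f hf using hM
  have h0 : ∀ q ∈ M, q = (q.1, f q.1) := fun q hq => hm q hq _ (hf _) (Or.inl rfl)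
  refine Finset.card_bij (fun q _ => q.1) (fun q hq => ?_) (fun q hq q' hq' h => ?_)
    fun i hi => ?_
  · simpa using (Finset.mem_filter.1 hq).2.1
  · rw [h0 q (Finset.mem_filter.1 hq).1, h0 q' (Finset.mem_filter.1 hq').1, h]
  · exact ⟨(i, f i), Finset.mem_filter.2 ⟨hf i, (Finset.mem_filter.1 hi).2,
      Subsingleton.elim _ _⟩, rfl⟩

variable [Fintype E]

/-- The right side involves neither `M` nor `η`. This is what makes the core size measurable up to
null sets although the choice of `M` is arbitrary at each sample point. -/
theorem setOf_price_eq (hM : IsMaxWeightMatching (mk.value ε η) M)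
    (hcard : Fintype.card L < Fintype.card E) (hτ : Function.Surjective mk.typeL)
    (hε : ∀ j k, ε j k ∈ Set.Icc (0 : ℝ) 1) (hη : ∀ i, 0 < η i 0) (hu : ∀ k, 0 ≤ mk.u k 0) (k : T)
    (q : Fin 1) :
    {a | ∃ α, mk.IsCorePrice ε η M α ∧ α k q = a} =
      (fun p : T → unitInterval => -(p k : ℝ)) '' priceSet mk.typeL ε := by
  have hsat : Saturates M := hM.saturates (fun i j => by
    rw [value_eq]
    have := hu (mk.typeL i)
    have := (hε j (mk.typeL i)).1
    have := hη i
    linarith) hcard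
  rw [Subsingleton.elim q 0]
  ext a
  constructor
  · rintro ⟨α, hα, rfl⟩
    have hs := hα.supports hsat hτ
    refine ⟨fun l => ⟨-α l 0, hs.price_nonneg hM.1 hcard (fun j k => (hε j k).1) l,
      hs.price_le_one hsat hτ (fun j k => (hε j k).2) l⟩, ⟨M, hM.1, hsat, hs⟩, by simp⟩
  · rintro ⟨p, ⟨M', hm, hs, hp⟩, rfl⟩
    have := isCorePrice_of_supports hp hm hs (fun k => (p k).2.1) (fun i => (hη i).le) hu
    exact ⟨_, this.of_isMaxWeightMatching hs hM, rfl⟩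

theorem coreSize_eq_meanGap [Fintype T] [DecidableEq T]
    (hM : IsMaxWeightMatching (mk.value ε η) M)
    (hcard : Fintype.card L < Fintype.card E) (hτ : Function.Surjective mk.typeL)
    (hε : ∀ j k, ε j k ∈ Set.Icc (0 : ℝ) 1) (hη : ∀ i, 0 < η i 0) (hu : ∀ k, 0 ≤ mk.u k 0) :
    mk.coreSize ε η M = meanGap mk.typeL ε := by
  have hsat : Saturates M := hM.saturates (fun i j => by
    rw [value_eq]
    have := hu (mk.typeL i)
    have := (hε j (mk.typeL i)).1
    have := hη i
    linarith) hcard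
  simp only [coreSize, meanGap, Fin.isValue, numMatches_eq hM.1 hsat, alphaMax,
    alphaMin, setOf_price_eq hM hcard hτ hε hη hu, priceGap, Finset.univ_unique,
    Finset.sum_singleton, Fin.default_eq_zero]

end Market

/-! ### Union bounds for independent samples. -/

section EmptyRegions

variable {E Y R : Type*} [Fintype E] [MeasurableSpace Y] (μ : Measure Y) [IsProbabilityMeasure μ]

theorem measureReal_forall_notMem {B : Set Y} (hB : MeasurableSet B) :
    (Measure.pi fun _ : E => μ).real {x | ∀ j, x j ∉ B} = (1 - μ.real B) ^ Fintype.card E := by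
  have : {x : E → Y | ∀ j, x j ∉ B} = Set.univ.pi fun _ => Bᶜ := by
    ext x; simp
  rw [this, Measure.real, Measure.pi_pi, Finset.prod_const, ENNReal.toReal_pow]
  change μ.real Bᶜ ^ _ = _
  rw [probReal_compl_eq_one_sub hB]
  rfl

/-- A union bound: with high probability no region of a finite family misses the sample. -/
theorem measureReal_exists_forall_notMem_le [Fintype R] {B : R → Set Y}
    (hB : ∀ r, MeasurableSet (B r)) {v : ℝ} (hv : ∀ r, v ≤ μ.real (B r)) :
    (Measure.pi fun _ : E => μ).real {x | ∃ r, ∀ j, x j ∉ B r} ≤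
      Fintype.card R * Real.exp (-(Fintype.card E * v)) := by
  have : {x : E → Y | ∃ r, ∀ j, x j ∉ B r} = ⋃ r, {x | ∀ j, x j ∉ B r} := by
    ext x; simp
  rw [this]
  refine (measureReal_iUnion_fintype_le _).trans ?_
  rw [← nsmul_eq_mul, ← Finset.card_univ]
  refine Finset.sum_le_card_nsmul _ _ _ fun r _ => ?_
  rw [measureReal_forall_notMem μ (hB r), ← mul_neg, Real.exp_nat_mul]
  refine pow_le_pow_left₀ (by linarith [measureReal_le_one (μ := μ) (s := B r)]) ?_ _
  have := Real.add_one_le_exp (-v)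
  linarith [hv r]

open Classical in
-- A union bound over the set of indices that fall in `A`. The crude factor `2 ^ card E` is
-- affordable because `q` will be chosen so small that `q ^ N` beats it.
theorem measureReal_le_card_filter_le {A : Set Y} {q : ℝ} (hq : μ.real A ≤ q) (hq1 : q ≤ 1)
    (N : ℕ) :
    (Measure.pi fun _ : E => μ).real {x | N ≤ (Finset.univ.filter fun j => x j ∈ A).card} ≤
      2 ^ Fintype.card E * q ^ N := by
  have hq0 : 0 ≤ q := measureReal_nonneg.trans hq
  have hsub : {x : E → Y | N ≤ (Finset.univ.filter fun j => x j ∈ A).card} ⊆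
      ⋃ S : {S : Finset E // N ≤ S.card}, Set.univ.pi fun j => if j ∈ S.1 then A else Set.univ := by
    intro x hx
    refine Set.mem_iUnion.2 ⟨⟨_, hx⟩, fun j _ => ?_⟩
    by_cases h : x j ∈ A <;> simp [h]
  refine (measureReal_mono hsub).trans ((measureReal_iUnion_fintype_le _).trans ?_)
  have hcard : (Fintype.card {S : Finset E // N ≤ S.card} : ℝ) ≤ 2 ^ Fintype.card E := by
    exact_mod_cast (Fintype.card_subtype_le _).trans_eq (Fintype.card_finset)
  refine le_trans ?_ (mul_le_mul_of_nonneg_right hcard (pow_nonneg hq0 N))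
  rw [← nsmul_eq_mul, ← Finset.card_univ]
  refine Finset.sum_le_card_nsmul _ _ _ fun S _ => ?_
  rw [Measure.real, Measure.pi_pi, ENNReal.toReal_prod]
  have : ∀ j, (μ (if j ∈ S.1 then A else Set.univ)).toReal = if j ∈ S.1 then μ.real A else 1 := by
    intro j; split_ifs <;> simp [Measure.real]
  simp only [this]
  rw [Finset.prod_ite_mem, Finset.univ_inter, Finset.prod_const]
  exact (pow_le_pow_left₀ measureReal_nonneg hq _).trans (pow_le_pow_of_le_one hq0 hq1 S.2)

end EmptyRegions

/-! ### Uniform laws on the cube and volumes of strips. -/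

/-- The uniform distribution on the unit interval. -/
noncomputable def unitLaw : Measure ℝ := volume.restrict (Set.Icc 0 1)

instance : IsProbabilityMeasure unitLaw := ⟨by simp [unitLaw]⟩

theorem unitLaw_Ioo {a b : ℝ} (ha : 0 ≤ a) (hab : a ≤ b) (hb : b ≤ 1) :
    unitLaw.real (Set.Ioo a b) = b - a := by
  rw [unitLaw, measureReal_restrict_apply measurableSet_Ioo, Set.inter_eq_left.2
    (Set.Ioo_subset_Icc_self.trans (Set.Icc_subset_Icc ha hb)), Real.volume_real_Ioo_of_le hab]

theorem unitLaw_Ici {a : ℝ} (ha : 0 ≤ a) (ha1 : a ≤ 1) : unitLaw.real (Set.Ici a) = 1 - a := by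
  have : Set.Ici a ∩ Set.Icc 0 1 = Set.Icc a 1 := by
    ext x
    simp only [Set.mem_inter_iff, Set.mem_Ici, Set.mem_Icc]
    exact ⟨fun h => ⟨h.1, h.2.2⟩, fun h => ⟨h.1, ha.trans h.1, h.2⟩⟩
  rw [unitLaw, measureReal_restrict_apply measurableSet_Ici, this, Real.volume_real_Icc_of_le ha1]

/-- The uniform distribution on the unit cube. -/
noncomputable def cubeLaw (T : Type*) [Fintype T] : Measure (T → ℝ) := Measure.pi fun _ => unitLaw

instance (T : Type*) [Fintype T] : IsProbabilityMeasure (cubeLaw T) := by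
  unfold cubeLaw; infer_instance

/-- The distribution of independent uniform points of the unit cube. -/
noncomputable def shockLaw (E T : Type*) [Fintype E] [Fintype T] : Measure (E → T → ℝ) :=
  Measure.pi fun _ => cubeLaw T

instance (E T : Type*) [Fintype E] [Fintype T] : IsProbabilityMeasure (shockLaw E T) := by
  unfold shockLaw; infer_instance

theorem cubeLaw_real_pi {T : Type*} [Fintype T] (s : T → Set ℝ) :
    (cubeLaw T).real (Set.univ.pi s) = ∏ i, unitLaw.real (s i) := by
  rw [cubeLaw, Measure.real, Measure.pi_pi, ENNReal.toReal_prod]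
  rfl

theorem cubeLaw_real_box {T : Type*} [Fintype T] {a b : T → ℝ} (ha : ∀ i, 0 ≤ a i)
    (hab : ∀ i, a i ≤ b i) (hb : ∀ i, b i ≤ 1) :
    (cubeLaw T).real (Set.univ.pi fun i => Set.Ioo (a i) (b i)) = ∏ i, (b i - a i) := by
  rw [cubeLaw_real_pi]
  exact Finset.prod_congr rfl fun i _ => unitLaw_Ioo (ha i) (hab i) (hb i)

theorem cubeLaw_real_eval {T : Type*} [Fintype T] (k : T) {s : Set ℝ} (hs : MeasurableSet s) :
    (cubeLaw T).real {x | x k ∈ s} = unitLaw.real s :=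
  (measurePreserving_eval (fun _ : T => unitLaw) k).measureReal_preimage hs.nullMeasurableSet

section Strip

variable {T : Type*} [DecidableEq T]

/-- A diagonal strip in the coordinates `k`, `l`, made of `w` cells of side `1 / N`, over the cube
of side `h` in the other coordinates. -/
def strip (N w : ℕ) (h : ℝ) (k l : T) (a b : ℕ) : Set (T → ℝ) :=
  ⋃ r ∈ Finset.range w, Set.univ.pi fun i =>
    if i = k then Set.Ioo (((a + r : ℕ) : ℝ) / N) (((a + r : ℕ) + 1 : ℝ) / N)
    else if i = l then Set.Ioo (((b + r : ℕ) : ℝ) / N) (((b + r : ℕ) + 1 : ℝ) / N)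
    else Set.Ioo 0 h

theorem measurableSet_strip [Countable T] (N w : ℕ) (h : ℝ) (k l : T) (a b : ℕ) :
    MeasurableSet (strip N w h k l a b) := by
  refine Finset.measurableSet_biUnion _ fun r _ => MeasurableSet.univ_pi fun i => ?_
  split_ifs <;> exact measurableSet_Ioo

theorem cubeLaw_real_strip [Fintype T] {N w : ℕ} (hN : 0 < N) {h : ℝ} (h0 : 0 ≤ h) (h1 : h ≤ 1)
    {k l : T} (hkl : k ≠ l) {a b : ℕ} (ha : a + w ≤ N) (hb : b + w ≤ N) :
    (cubeLaw T).real (strip N w h k l a b) = w * (h ^ (Fintype.card T - 2) / N ^ 2) := by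
  have hN' : (0 : ℝ) < N := by exact_mod_cast hN
  have hcell : ∀ t : ℕ, t + 1 ≤ N →
      unitLaw.real (Set.Ioo ((t : ℝ) / N) ((t + 1 : ℝ) / N)) = 1 / N := by
    intro t ht
    rw [unitLaw_Ioo (by positivity) (by gcongr; linarith)]
    · ring
    · rw [div_le_one hN']; exact_mod_cast ht
  rw [strip, measureReal_biUnion_finset]
  · rw [← nsmul_eq_mul, ← Finset.card_range w, Finset.card_range]
    conv_rhs => rw [← Finset.card_range w]
    rw [← Finset.sum_const]
    refine Finset.sum_congr rfl fun r hr => ?_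
    have hr := Finset.mem_range.1 hr
    rw [cubeLaw_real_pi, ← Finset.mul_prod_erase _ _ (Finset.mem_univ k),
      ← Finset.mul_prod_erase _ _ (Finset.mem_erase.2 ⟨hkl.symm, Finset.mem_univ l⟩)]
    have hrest : ∀ i ∈ (Finset.univ.erase k).erase l, unitLaw.real
        (if i = k then Set.Ioo (((a + r : ℕ) : ℝ) / N) (((a + r : ℕ) + 1 : ℝ) / N)
        else if i = l then Set.Ioo (((b + r : ℕ) : ℝ) / N) (((b + r : ℕ) + 1 : ℝ) / N)
        else Set.Ioo 0 h) = h := by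
      intro i hi
      simp only [Finset.mem_erase, Finset.mem_univ, and_true] at hi
      rw [if_neg hi.2, if_neg hi.1, unitLaw_Ioo le_rfl h0 h1, sub_zero]
    rw [Finset.prod_congr rfl hrest, Finset.prod_const, if_pos rfl, if_neg hkl.symm, if_pos rfl,
      hcell _ (by omega), hcell _ (by omega),
      Finset.card_erase_of_mem (Finset.mem_erase.2 ⟨hkl.symm, Finset.mem_univ l⟩),
      Finset.card_erase_of_mem (Finset.mem_univ k), Finset.card_univ, Nat.sub_sub]
    field_simp
  · intro r _ s _ hrs
    refine Set.disjoint_left.2 fun x hx hx' => hrs ?_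
    have h1 := hx k (Set.mem_univ k)
    have h2 := hx' k (Set.mem_univ k)
    simp only [if_true, Set.mem_Ioo, div_lt_iff₀ hN', lt_div_iff₀ hN'] at h1 h2
    have h3 : ((a + r : ℕ) : ℝ) < (a + s : ℕ) + 1 := h1.1.trans h2.2
    have h4 : ((a + s : ℕ) : ℝ) < (a + r : ℕ) + 1 := h2.1.trans h1.2
    norm_cast at h3 h4
    omega
  · intro r _
    refine MeasurableSet.univ_pi fun i => ?_
    split_ifs <;> exact measurableSet_Ioo

end Strip

/-! ### The mean reciprocal volume. -/

section Reciprocal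

/-- Truncation at `δ` tames the divergent integral of `1 / t`: the part below `δ` contributes `1`,
the rest the logarithm. -/
theorem integral_inv_max_unitLaw {δ : ℝ} (hδ : 0 < δ) (hδ1 : δ ≤ 1) :
    ∫ t, (max t δ)⁻¹ ∂unitLaw = 1 + Real.log δ⁻¹ := by
  have hint : ∀ a b : ℝ, IntervalIntegrable (fun t : ℝ => (max t δ)⁻¹) volume a b := fun a b =>
    Continuous.intervalIntegrable (Continuous.inv₀ (by fun_prop) fun t =>
      (lt_of_lt_of_le hδ (le_max_right _ _)).ne') _ _
  rw [unitLaw, integral_Icc_eq_integral_Ioc, ← intervalIntegral.integral_of_le zero_le_one,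
    ← intervalIntegral.integral_add_adjacent_intervals (hint 0 δ) (hint δ 1)]
  have h1 : ∫ t in (0 : ℝ)..δ, (max t δ)⁻¹ = ∫ t in (0 : ℝ)..δ, δ⁻¹ :=
    intervalIntegral.integral_congr fun t ht => by
      rw [Set.uIcc_of_le hδ.le] at ht
      simp only [max_eq_right ht.2]
  have h2 : ∫ t in δ..(1 : ℝ), (max t δ)⁻¹ = ∫ t in δ..(1 : ℝ), t⁻¹ :=
    intervalIntegral.integral_congr fun t ht => by
      rw [Set.uIcc_of_le hδ1] at ht
      simp only [max_eq_left ht.1]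
  rw [h1, h2, integral_inv_of_pos hδ one_pos, intervalIntegral.integral_const]
  simp [hδ.ne']

variable {E T : Type*} [Fintype E] [Fintype T]

/-- The sum over the sample of the reciprocal volumes of the boxes below the points, the points
being moved to coordinates at least `δ`. -/
noncomputable def recipVolume (δ : ℝ) (ε : E → T → ℝ) : ℝ := ∑ j, ∏ k, (max (ε j k) δ)⁻¹

theorem integrable_prod_inv_max {δ : ℝ} (hδ : 0 < δ) (j : E) :
    Integrable (fun ε : E → T → ℝ => ∏ k, (max (ε j k) δ)⁻¹) (shockLaw E T) := by
  refine Integrable.of_bound (C := (δ⁻¹) ^ Fintype.card T) ?_ (ae_of_all _ fun ε => ?_)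
  · exact (Finset.measurable_prod _ fun k _ => (by fun_prop)).aestronglyMeasurable
  · have h0 : ∀ k, 0 ≤ (max (ε j k) δ)⁻¹ := fun k =>
      inv_nonneg.2 (hδ.le.trans (le_max_right _ _))
    rw [Real.norm_of_nonneg (Finset.prod_nonneg fun k _ => h0 k), ← Finset.card_univ,
      ← Finset.prod_const]
    exact Finset.prod_le_prod (fun k _ => h0 k) fun k _ => inv_anti₀ hδ (le_max_right _ _)

theorem integrable_recipVolume {δ : ℝ} (hδ : 0 < δ) :
    Integrable (recipVolume δ : (E → T → ℝ) → ℝ) (shockLaw E T) :=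
  integrable_finsetSum _ fun j _ => integrable_prod_inv_max hδ j

theorem integral_recipVolume {δ : ℝ} (hδ : 0 < δ) (hδ1 : δ ≤ 1) :
    ∫ ε : E → T → ℝ, recipVolume δ ε ∂shockLaw E T =
      Fintype.card E * (1 + Real.log δ⁻¹) ^ Fintype.card T := by
  unfold recipVolume
  rw [integral_finsetSum _ fun j _ => integrable_prod_inv_max hδ j, ← nsmul_eq_mul,
    ← Finset.card_univ, ← Finset.sum_const]
  refine Finset.sum_congr rfl fun j _ => ?_
  have hmap : (shockLaw E T).map (fun ε => ε j) = cubeLaw T :=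
    (measurePreserving_eval (fun _ : E => cubeLaw T) j).map_eq
  have hmeas : Measurable fun x : T → ℝ => ∏ k, (max (x k) δ)⁻¹ :=
    Finset.measurable_prod _ fun k _ => by fun_prop
  rw [← integral_inv_max_unitLaw hδ hδ1,
    ← integral_fintype_prod_eq_pow (ι := T) (fun t : ℝ => (max t δ)⁻¹) (μ := unitLaw), ← cubeLaw, ← hmap,
    integral_map (measurable_pi_apply j).aemeasurable hmeas.aestronglyMeasurable]

end Reciprocal

/-! ### The law of the shocks. -/

/-- The productivities `ε` are distributed as independent uniform points of the unit cube. -/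
theorem IsUniformShocks.map_eq {L E T S Ω : Type*} [Fintype E] [Fintype T] [MeasurableSpace Ω]
    {P : Measure Ω} {ε : E → T → Ω → ℝ} {η : L → S → Ω → ℝ} (h : IsUniformShocks P ε η) :
    P.map (fun ω j k => ε j k ω) = shockLaw E T := by
  have hP : IsProbabilityMeasure P := h.indep.isProbabilityMeasure
  have hu : ∀ j k, P.map (ε j k) = unitLaw := fun j k => by
    have := h.uniform_ε j k
    rw [pdf.IsUniform, ProbabilityTheory.cond] at this
    rw [this, unitLaw]
    simp
  have hind : iIndepFun (fun (q : E × T) ω => ε q.1 q.2 ω) P :=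
    h.indep.precomp (g := Sum.inl) Sum.inl_injective
  have h1 := hind.map_fun_eq_pi_map fun (q : E × T) => (h.measurable_ε q.1 q.2).aemeasurable
  have h2 : P.map (fun ω j k => ε j k ω) =
      (P.map fun ω (q : E × T) => ε q.1 q.2 ω).map (MeasurableEquiv.curry E T ℝ) := by
    rw [Measure.map_map (MeasurableEquiv.measurable _)
      (measurable_pi_lambda _ fun q : E × T => h.measurable_ε q.1 q.2)]
    rfl
  have h3 := Measure.infinitePi_map_curry (ι := E) (κ := T) (X := ℝ) fun _ _ => unitLaw
  simp only [Measure.infinitePi_eq_pi] at h3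
  rw [h2, h1]
  simp only [hu]
  rw [shockLaw]
  exact h3

/-- Strictness matters: with `u` and `ε` only nonnegative, it is `η` that makes pair values
positive, so that every worker is matched. -/
theorem IsUniformShocks.ae_pos {L E T S Ω : Type*} [Fintype L] [Fintype S] [MeasurableSpace Ω]
    {P : Measure Ω} {ε : E → T → Ω → ℝ} {η : L → S → Ω → ℝ} (h : IsUniformShocks P ε η) :
    ∀ᵐ ω ∂P, ∀ i q, 0 < η i q ω := by
  refine ae_all_iff.2 fun i => ae_all_iff.2 fun q => ?_
  have := h.uniform_η i q
  rw [pdf.IsUniform, ProbabilityTheory.cond] at this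
  refine ae_of_ae_map (h.measurable_η i q).aemeasurable (p := fun t => 0 < t) ?_
  rw [this]
  refine Measure.ae_smul_measure ?_ _
  rw [← restrict_Ioc_eq_restrict_Icc]
  exact (ae_restrict_mem measurableSet_Ioc).mono fun t ht => ht.1

theorem ae_shockLaw_mem_Icc (E T : Type*) [Fintype E] [Fintype T] :
    ∀ᵐ ε ∂shockLaw E T, ∀ j k, ε j k ∈ Set.Icc (0 : ℝ) 1 := by
  have h1 : ∀ᵐ t ∂unitLaw, t ∈ Set.Icc (0 : ℝ) 1 := ae_restrict_mem measurableSet_Icc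
  refine ae_all_iff.2 fun j => ae_all_iff.2 fun k => ?_
  have h2 := (measurePreserving_eval (fun _ : T => unitLaw) k).quasiMeasurePreserving.ae h1
  exact (measurePreserving_eval (fun _ : E => cubeLaw T) j).quasiMeasurePreserving.ae h2

theorem InCore.isMaxWeightMatching {L E : Type*} [Fintype L] [Fintype E] {Φ : L → E → ℝ}
    {M : Finset (L × E)} {x : L → ℝ} {y : E → ℝ} (h : InCore Φ M x y) :
    IsMaxWeightMatching Φ M :=
  ⟨h.1.matching, fun M' hM' => h.1.weight_eq ▸
    h.2 Finset.univ Finset.univ M' hM' (by simp [Finset.univ_product_univ])⟩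

/-- All price vectors of the price set support the same matchings. -/
theorem exists_common_matching {L E T : Type*} [Fintype L] [Fintype E] {τ : L → T}
    (hτ : Function.Surjective τ) {ε : E → T → ℝ} {p p' : T → unitInterval}
    (hp : p ∈ priceSet τ ε) (hp' : p' ∈ priceSet τ ε) :
    ∃ M : Finset (L × E), IsMatching M ∧ Saturates M ∧ Supports τ M ε (fun k => (p k : ℝ)) ∧
      Supports τ M ε fun k => (p' k : ℝ) := by
  obtain ⟨M, hM, hsat, hp⟩ := hp
  obtain ⟨M', hM', hsat', hp'⟩ := hp'
  -- In the market with `u = 0` and `η = 0` both vectors are core prices, so `p` carries over to the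
  -- maximum weight matching `M'`.
  set mk : Market L E T (Fin 1) := ⟨τ, fun _ => 0, fun _ _ => 0⟩
  have h1 := Market.isCorePrice_of_supports (mk := mk) (η := fun _ _ => 0) hp hM hsat
    (fun k => (p k).2.1) (fun _ => le_rfl) (fun _ => le_rfl)
  have h2 := Market.isCorePrice_of_supports (mk := mk) (η := fun _ _ => 0) hp' hM' hsat'
    (fun k => (p' k).2.1) (fun _ => le_rfl) (fun _ => le_rfl)
  have hmax : IsMaxWeightMatching (mk.value ε fun _ _ => 0) M' := by
    obtain ⟨x, y, hc, -⟩ := h2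
    exact hc.isMaxWeightMatching
  have h3 := (h1.of_isMaxWeightMatching hsat hmax).supports hsat' hτ
  simp only [neg_neg] at h3
  exact ⟨M', hM', hsat', h3, hp'⟩

/-! ### Deterministic bounds on price differences. -/

section GapBounds

variable {L E T : Type*} {τ : L → T} {M : Finset (L × E)} {ε : E → T → ℝ} {p p' : T → ℝ}

/-- If every diagonal strip of width about `1 / N` contains a sample point, the changes of two
prices between two supporting price vectors differ by at most `4 / N`. -/
theorem Supports.sub_sub_sub_le [DecidableEq T] (hp : Supports τ M ε p) (hp' : Supports τ M ε p')
    {N w : ℕ} {h : ℝ} (hN : 0 < N) (hNh : 2 ≤ N * h) (hw : (w : ℝ) + 1 ≤ N * h)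
    (hp0 : ∀ i, 0 ≤ p' i) (hp1 : ∀ i, p' i + 2 * h ≤ 1) {k l : T} (hkl : k ≠ l)
    (hstrip : ∀ a b : ℕ, a + w ≤ N → b + w ≤ N → ∃ j, ε j ∈ strip N w h k l a b) :
    (p k - p' k) - (p l - p' l) ≤ 4 / N := by
  by_contra! hg
  have hN' : (0 : ℝ) < N := by exact_mod_cast hN
  have hh : 0 < h := by
    by_contra! h0
    nlinarith
  have hNg : 4 < N * ((p k - p' k) - (p l - p' l)) := by
    rwa [div_lt_iff₀ hN', mul_comm] at hg
  -- The least grid index beyond `p' k + h`: in the strip, type `k` then yields more than `h` at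
  -- prices `p'`.
  set a : ℕ := ⌊N * (p' k + h)⌋₊ + 1 with ha
  have ha0 : 0 ≤ N * (p' k + h) := mul_nonneg hN'.le (by linarith [hp0 k])
  have ha1 : (a : ℝ) ≤ N * (p' k + h) + 1 := by
    rw [ha]; push_cast; linarith [Nat.floor_le ha0]
  have ha2 : N * (p' k + h) < a := by
    rw [ha]; push_cast; exact Nat.lt_floor_add_one _
  -- With `b` the largest integer below `z`, the difference `ε j k - ε j l` on the strip lies
  -- strictly above `p' k - p' l` and exceeds it by less than `3 / N`, hence stays below `p k - p
  -- l`.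
  set z : ℝ := a - 1 - N * (p' k - p' l) with hz
  have hpl : 0 ≤ N * p' l := mul_nonneg hN'.le (hp0 l)
  have hz1 : 1 < z := by rw [hz]; nlinarith
  have hceil : 1 ≤ ⌈z⌉₊ := Nat.one_le_ceil_iff.2 (by linarith)
  set b : ℕ := ⌈z⌉₊ - 1 with hb
  have hb' : (b : ℝ) = (⌈z⌉₊ : ℝ) - 1 := by rw [hb]; push_cast [hceil]; ring
  have hb1 : (b : ℝ) < z := by
    have := Nat.ceil_lt_add_one (show 0 ≤ z by linarith)
    linarith
  have hb2 : z - 1 ≤ b := by linarith [Nat.le_ceil z]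
  have haw : a + w ≤ N := by
    have : (a : ℝ) + w ≤ N := by nlinarith [hp1 k]
    exact_mod_cast this
  have hbw : b + w ≤ N := by
    have : (b : ℝ) + w ≤ N := by nlinarith [hp1 l]
    exact_mod_cast this
  obtain ⟨j, hj⟩ := hstrip a b haw hbw
  simp only [strip, Set.mem_iUnion, Finset.mem_range, exists_prop] at hj
  obtain ⟨r, -, hj⟩ := hj
  have hk := hj k (Set.mem_univ k)
  have hl := hj l (Set.mem_univ l)
  simp only [if_true, if_neg hkl.symm, Set.mem_Ioo, div_lt_iff₀ hN', lt_div_iff₀ hN'] at hk hl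
  push_cast at hk hl
  have hr : (0 : ℝ) ≤ r := Nat.cast_nonneg r
  have hk1 : p' k + h < ε j k := by
    by_contra! hcon
    nlinarith
  have hkl1 : p' k - p' l < ε j k - ε j l := by
    by_contra! hcon
    nlinarith
  have hkl2 : ε j k - ε j l < p k - p l := by
    by_contra! hcon
    nlinarith
  -- At `p'`, type `k` beats `l` by the position of the strip, and beats any other type because
  -- those coordinates are below `h`.
  refine hp.not_strict hp' (j := j) (k := k) (l := l) (fun i hi => ?_) (by linarith) (by linarith)
  by_cases hil : i = l
  · subst hil; linarith
  · have h3 := hj i (Set.mem_univ i)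
    simp only [if_neg hi, if_neg hil] at h3
    linarith [h3.2, hp0 i]

/-- If every box of volume at least `v` with corners on the grid of mesh `1 / n` contains a sample
point, the box between two supporting price vectors is thin. -/
theorem Supports.sub_mul_prod_le [Fintype T] [DecidableEq T] (hp : Supports τ M ε p)
    (hp' : Supports τ M ε p') {n : ℕ} (hn : 0 < n) {v : ℝ} (hp0 : ∀ i, 0 ≤ p' i)
    (hp1 : ∀ i, p i ≤ 1) {k : T} (hk : 4 / n ≤ p k - p' k) (hpn : ∀ i, 4 / n ≤ p i)
    (hgrid : ∀ lo hi : T → Fin (n + 1), (∀ i, lo i ≤ hi i) →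
      v ≤ ∏ i, (((hi i : ℕ) : ℝ) / n - ((lo i : ℕ) : ℝ) / n) →
      ∃ j, ∀ i, ε j i ∈ Set.Ioo (((lo i : ℕ) : ℝ) / n) (((hi i : ℕ) : ℝ) / n)) :
    (p k - p' k) * ∏ i ∈ Finset.univ.erase k, p i ≤ 2 ^ Fintype.card T * v := by
  by_contra! hcon
  have hn' : (0 : ℝ) < n := by exact_mod_cast hn
  have hpos : ∀ i, 0 ≤ p i := fun i => (by positivity : (0 : ℝ) ≤ 4 / n).trans (hpn i)
  have hhi : ∀ i, ⌊n * p i⌋₊ < n + 1 := fun i => Nat.lt_succ_of_le <| by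
    have := Nat.floor_le (mul_nonneg hn'.le (hpos i))
    have : (⌊n * p i⌋₊ : ℝ) ≤ n := this.trans (by nlinarith [hp1 i])
    exact_mod_cast this
  have hgap : n * p' k + 4 ≤ n * p k := by
    rw [div_le_iff₀ hn'] at hk; linarith
  have hceil : (⌈n * p' k⌉₊ : ℝ) < n * p' k + 1 := Nat.ceil_lt_add_one (mul_nonneg hn'.le (hp0 k))
  have hfloor : ∀ i, n * p i - 1 < ⌊n * p i⌋₊ := fun i => by
    linarith [Nat.lt_floor_add_one (n * p i)]
  have hlohi : ⌈n * p' k⌉₊ ≤ ⌊n * p k⌋₊ := by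
    have : (⌈n * p' k⌉₊ : ℝ) ≤ ⌊n * p k⌋₊ := by linarith [hfloor k]
    exact_mod_cast this
  set lo : T → Fin (n + 1) := fun i =>
    if i = k then ⟨⌈n * p' k⌉₊, hlohi.trans_lt (hhi k)⟩ else 0 with hlo
  set hi : T → Fin (n + 1) := fun i => ⟨⌊n * p i⌋₊, hhi i⟩ with hhi'
  -- Rounding inwards costs a side at most `2 / n`; sides have length at least `4 / n`, so half of
  -- each survives, whence the factor `2 ^ card T`.
  have hvol : v ≤ ∏ i, (((hi i : ℕ) : ℝ) / n - ((lo i : ℕ) : ℝ) / n) := by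
    have h1 : ∏ i, (if i = k then p k - p' k else p i) / 2 ≤
        ∏ i, (((hi i : ℕ) : ℝ) / n - ((lo i : ℕ) : ℝ) / n) := by
      refine Finset.prod_le_prod (fun i _ => ?_) fun i _ => ?_
      · split_ifs with h
        · have : (0 : ℝ) ≤ 4 / n := by positivity
          linarith
        · linarith [hpos i]
      · rw [← sub_div, le_div_iff₀ hn']
        by_cases h : i = k
        · subst h
          simp only [hhi', hlo, if_true]
          linarith [hfloor i]
        · simp only [hhi', hlo, if_neg h, Fin.val_zero, Nat.cast_zero, sub_zero]
          have := hpn i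
          rw [div_le_iff₀ hn'] at this
          linarith [hfloor i]
    refine le_trans ?_ h1
    rw [Finset.prod_div_distrib, Finset.prod_const, Finset.card_univ, le_div_iff₀ (by positivity),
      ← Finset.mul_prod_erase _ _ (Finset.mem_univ k), if_pos rfl,
      Finset.prod_congr rfl fun i hi => if_neg (Finset.ne_of_mem_erase hi)]
    linarith
  obtain ⟨j, hj⟩ := hgrid lo hi (fun i => by
    by_cases h : i = k
    · subst h
      simpa only [hhi', hlo, if_true, Fin.mk_le_mk] using hlohi
    · simp only [hlo, if_neg h, Fin.zero_le]) hvol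
  refine hp.not_between hp' (j := j) (k := k) ?_ fun i => ?_
  · have := (hj k).1
    simp only [hlo, if_true] at this
    refine lt_of_le_of_lt ?_ this
    rw [le_div_iff₀ hn', mul_comm]
    exact Nat.le_ceil _
  · have := (hj i).2
    simp only [hhi'] at this
    refine lt_of_lt_of_le this ?_
    rw [div_le_iff₀ hn', mul_comm (p i)]
    exact Nat.floor_le (mul_nonneg hn'.le (hpos i))

/-- The volume of the box below the prices controls the number of unmatched employers. -/
theorem Supports.mul_inv_prod_le [Fintype L] [Fintype E] [Fintype T] (hp : Supports τ M ε p)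
    (hM : IsMatching M) {δ : ℝ} (hδ : 0 < δ) (hpδ : ∀ i, δ ≤ p i) :
    ((Fintype.card E : ℝ) - Fintype.card L) * (∏ i, p i)⁻¹ ≤ recipVolume δ ε := by
  classical
  have hV : 0 < (∏ i, p i)⁻¹ := inv_pos.2 (Finset.prod_pos fun i _ => hδ.trans_le (hpδ i))
  have hcard : ((Fintype.card E : ℝ) - Fintype.card L) ≤
      (Finset.univ.filter fun j : E => ∀ i : L, (i, j) ∉ M).card := by
    rw [sub_le_iff_le_add]
    have := hM.card_unmatched
    exact_mod_cast Nat.sub_le_iff_le_add.1 this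
  have hnn : ∀ j, 0 ≤ ∏ k, (max (ε j k) δ)⁻¹ := fun j => Finset.prod_nonneg fun k _ =>
    inv_nonneg.2 (hδ.le.trans (le_max_right _ _))
  calc _ ≤ ((Finset.univ.filter fun j : E => ∀ i : L, (i, j) ∉ M).card : ℝ) * (∏ i, p i)⁻¹ :=
        mul_le_mul_of_nonneg_right hcard hV.le
    _ = ∑ j ∈ Finset.univ.filter fun j : E => ∀ i : L, (i, j) ∉ M, (∏ i, p i)⁻¹ := by
        rw [Finset.sum_const, nsmul_eq_mul]
    -- Unmatched points lie below `p`, even after truncation since `δ ≤ p i`. This Markov-type count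
    -- holds for all `p` at once.
    _ ≤ ∑ j ∈ Finset.univ.filter fun j : E => ∀ i : L, (i, j) ∉ M, ∏ k, (max (ε j k) δ)⁻¹ := by
        refine Finset.sum_le_sum fun j hj => ?_
        rw [← Finset.prod_inv_distrib]
        refine Finset.prod_le_prod (fun i _ => inv_nonneg.2 (hδ.le.trans (hpδ i))) fun i _ => ?_
        exact inv_anti₀ (lt_of_lt_of_le hδ (le_max_right _ _))
          (max_le (hp.unmatched j (Finset.mem_filter.1 hj).2 i) (hpδ i))
    _ ≤ _ := Finset.sum_le_sum_of_subset_of_nonneg (Finset.subset_univ _) fun j _ _ => hnn j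

end GapBounds

/-- The product of all but the smallest of `K` positive numbers is at least the product of all of
them to the power `(K - 1) / K`. -/
theorem prod_rpow_le_prod_erase {T : Type*} [Fintype T] [DecidableEq T] {p : T → ℝ}
    (hp : ∀ i, 0 < p i) {k : T} (hk : ∀ i, p k ≤ p i) :
    (∏ i, p i) ^ (((Fintype.card T : ℝ) - 1) / Fintype.card T) ≤
      ∏ i ∈ Finset.univ.erase k, p i := by
  have hK : 0 < Fintype.card T := Fintype.card_pos_iff.2 ⟨k⟩
  have hK' : (0 : ℝ) < Fintype.card T := by exact_mod_cast hK
  set Q := ∏ i ∈ Finset.univ.erase k, p i with hQ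
  have hQ0 : 0 < Q := Finset.prod_pos fun i _ => hp i
  have hV : ∏ i, p i = p k * Q := (Finset.mul_prod_erase _ _ (Finset.mem_univ k)).symm
  have h1 : p k ^ (Fintype.card T - 1) ≤ Q := by
    rw [← Finset.card_univ, ← Finset.card_erase_of_mem (Finset.mem_univ k), ← Finset.prod_const]
    exact Finset.prod_le_prod (fun i _ => (hp k).le) fun i _ => hk i
  -- Multiply `h1` by `Q ^ (card T - 1)`; the `card T`-th root is the claim.
  have h2 : (p k * Q) ^ (Fintype.card T - 1) ≤ Q ^ Fintype.card T := by
    obtain ⟨m, hm⟩ := Nat.exists_eq_succ_of_ne_zero hK.ne'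
    rw [hm] at h1 ⊢
    simp only [Nat.succ_eq_add_one, Nat.add_sub_cancel] at h1 ⊢
    rw [mul_pow, pow_succ', mul_comm]
    calc Q ^ m * p k ^ m ≤ Q ^ m * Q := by gcongr
      _ = Q * Q ^ m := mul_comm _ _
  have h3 : ((p k * Q) ^ (Fintype.card T - 1)) ^ ((Fintype.card T : ℝ)⁻¹) ≤
      (Q ^ Fintype.card T) ^ ((Fintype.card T : ℝ)⁻¹) :=
    Real.rpow_le_rpow (pow_nonneg (mul_nonneg (hp k).le hQ0.le) _) h2 (by positivity)
  rw [Real.pow_rpow_inv_natCast hQ0.le hK.ne', ← Real.rpow_natCast,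
    ← Real.rpow_mul (mul_nonneg (hp k).le hQ0.le)] at h3
  rw [hV]
  convert h3 using 2
  rw [Nat.cast_sub hK, Nat.cast_one]
  rfl

/-! ### The gap for a typical sample. -/

section GoodSample

variable {L E T : Type*} [Fintype E] [Fintype T] [DecidableEq T]

/-- A typical sample: few points are close to the upper faces of the cube, and no diagonal strip
and no large grid box is empty. -/
structure IsTypical (B N w n : ℕ) (h v : ℝ) (ε : E → T → ℝ) : Prop where
  mem_Icc : ∀ j k, ε j k ∈ Set.Icc (0 : ℝ) 1
  upper : ∀ k, (Finset.univ.filter fun j => 1 - 2 * h ≤ ε j k).card < B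
  strip : ∀ k l, k ≠ l → ∀ a b : ℕ, a + w ≤ N → b + w ≤ N → ∃ j, ε j ∈ strip N w h k l a b
  grid : ∀ lo hi : T → Fin (n + 1), (∀ i, lo i ≤ hi i) →
    v ≤ ∏ i, (((hi i : ℕ) : ℝ) / n - ((lo i : ℕ) : ℝ) / n) →
    ∃ j, ∀ i, ε j i ∈ Set.Ioo (((lo i : ℕ) : ℝ) / n) (((hi i : ℕ) : ℝ) / n)

/-- The strips reduce the gap of `k` to that of the cheapest type, the empty box bounds the latter
through the volume below `p`, and the unmatched employers bound that volume from below. -/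
theorem IsTypical.priceGap_le [Fintype L] {τ : L → T} {B N w n : ℕ} {h v g : ℝ} {ε : E → T → ℝ}
    (hε : IsTypical B N w n h v ε) (hcard : Fintype.card L < Fintype.card E)
    (hτ : Function.Surjective τ) (hB : ∀ k, B ≤ (Finset.univ.filter fun i => τ i = k).card) (hN : 0 < N)
    (hNh : 2 ≤ N * h) (hw : (w : ℝ) + 1 ≤ N * h) (hn : 0 < n) (hv : 0 ≤ v) (hg : 4 / (N : ℝ) ≤ g)
    (hng : 4 / (n : ℝ) ≤ g) (k : T) :
    priceGap τ ε k ≤ 2 * g + 2 ^ Fintype.card T * v *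
      (recipVolume (n : ℝ)⁻¹ ε / ((Fintype.card E : ℝ) - Fintype.card L)) ^
        (((Fintype.card T : ℝ) - 1) / Fintype.card T) := by
  have hn' : (0 : ℝ) < n := by exact_mod_cast hn
  have hg0 : 0 < g := lt_of_lt_of_le (by positivity) hng
  have hm : (0 : ℝ) < (Fintype.card E : ℝ) - Fintype.card L := by
    rw [sub_pos]; exact_mod_cast hcard
  have hR : 0 ≤ recipVolume (n : ℝ)⁻¹ ε := Finset.sum_nonneg fun j _ => Finset.prod_nonneg
    fun k _ => inv_nonneg.2 ((inv_nonneg.2 hn'.le).trans (le_max_right _ _))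
  have hK : (1 : ℝ) ≤ Fintype.card T := by
    exact_mod_cast (Fintype.card_pos_iff.2 ⟨k⟩ : 0 < Fintype.card T)
  set s : ℝ := ((Fintype.card T : ℝ) - 1) / Fintype.card T with hs
  have hs0 : 0 ≤ s := div_nonneg (by linarith) (by linarith)
  have hlast : 0 ≤ 2 ^ Fintype.card T * v *
      (recipVolume (n : ℝ)⁻¹ ε / ((Fintype.card E : ℝ) - Fintype.card L)) ^ s :=
    mul_nonneg (by positivity) (Real.rpow_nonneg (div_nonneg hR hm.le) _)
  refine _root_.priceGap_le (by linarith) ?_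
  intro p hp p' hp'
  obtain ⟨M, hM, hsat, hp, hp'⟩ := exists_common_matching hτ hp hp'
  have hp0 : ∀ i, (0 : ℝ) ≤ p' i := fun i => (p' i).2.1
  -- Otherwise all workers of type `i`, at least `B`, would be matched into a top slab with fewer
  -- than `B` points.
  have hp1 : ∀ i, (p' i : ℝ) + 2 * h ≤ 1 := by
    intro i
    by_contra! hcon
    refine absurd (((hB i).trans (hp'.card_le hM hsat i)).trans (Finset.card_le_card ?_))
      (not_le.2 (hε.upper i))
    intro j hj
    simp only [Finset.mem_filter, Finset.mem_univ, true_and] at hj ⊢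
    linarith
  have hdiff : ∀ i l, ((p i : ℝ) - p' i) - ((p l : ℝ) - p' l) ≤ g := by
    intro i l
    by_cases hil : i = l
    · subst hil; simpa using hg0.le
    · exact (hp.sub_sub_sub_le hp' hN hNh hw hp0 hp1 hil (hε.strip i l hil)).trans hg
  by_contra! hcon
  -- The gap of `k` now exceeds `2 * g` and the others differ from it by at most `g`. So every side
  -- of the box is long enough for the grid.
  have hlow : ∀ i, g ≤ (p i : ℝ) - p' i := fun i => by linarith [hdiff k i]
  have hpn : ∀ i, 4 / (n : ℝ) ≤ p i := fun i => by linarith [hlow i, hp0 i]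
  have hppos : ∀ i, (0 : ℝ) < p i := fun i => lt_of_lt_of_le (by positivity) (hpn i)
  obtain ⟨l, -, hl⟩ := Finset.exists_min_image Finset.univ (fun i => (p i : ℝ)) ⟨k, Finset.mem_univ k⟩
  have hslab := hp.sub_mul_prod_le hp' hn (v := v) hp0 (fun i => (p i).2.2) (k := l)
    (hng.trans (hlow l)) hpn hε.grid
  have hQ := prod_rpow_le_prod_erase hppos fun i => hl i (Finset.mem_univ i)
  have hV : 0 < ∏ i, (p i : ℝ) := Finset.prod_pos fun i _ => hppos i
  have hY : (∏ i, (p i : ℝ))⁻¹ ≤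
      recipVolume (n : ℝ)⁻¹ ε / ((Fintype.card E : ℝ) - Fintype.card L) := by
    rw [le_div_iff₀ hm, mul_comm]
    refine hp.mul_inv_prod_le hM (inv_pos.2 hn') fun i => le_trans ?_ (hpn i)
    rw [inv_eq_one_div]
    gcongr
    norm_num
  have hVs : 0 < (∏ i, (p i : ℝ)) ^ s := Real.rpow_pos_of_pos hV _
  have hYs : ((∏ i, (p i : ℝ)) ^ s)⁻¹ ≤
      (recipVolume (n : ℝ)⁻¹ ε / ((Fintype.card E : ℝ) - Fintype.card L)) ^ s := by
    rw [← Real.inv_rpow hV.le]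
    exact Real.rpow_le_rpow (inv_nonneg.2 hV.le) hY hs0
  have hlV : ((p l : ℝ) - p' l) * (∏ i, (p i : ℝ)) ^ s ≤ 2 ^ Fintype.card T * v :=
    (mul_le_mul_of_nonneg_left hQ (by linarith [hlow l])).trans hslab
  have hl2 : (p l : ℝ) - p' l ≤ 2 ^ Fintype.card T * v * ((∏ i, (p i : ℝ)) ^ s)⁻¹ := by
    rwa [← div_eq_mul_inv, le_div_iff₀ hVs]
  have hl3 := hl2.trans (mul_le_mul_of_nonneg_left hYs (by positivity))
  linarith [hdiff k l]

end GoodSample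

/-! ### Probability of an atypical sample. -/

section TypicalProbability

variable {E T : Type*} [Fintype E] [Fintype T]

theorem shockLaw_real_upper_le {h : ℝ} (h0 : 0 ≤ 2 * h) (h1 : 2 * h ≤ 1) (B : ℕ) :
    (shockLaw E T).real {ε | ∃ k, B ≤ (Finset.univ.filter fun j => 1 - 2 * h ≤ ε j k).card} ≤
      Fintype.card T * (2 ^ Fintype.card E * (2 * h) ^ B) := by
  have : {ε : E → T → ℝ | ∃ k, B ≤ (Finset.univ.filter fun j => 1 - 2 * h ≤ ε j k).card} =
      ⋃ k, {ε | B ≤ (Finset.univ.filter fun j => 1 - 2 * h ≤ ε j k).card} := by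
    ext ε; simp
  rw [this]
  refine (measureReal_iUnion_fintype_le _).trans ?_
  rw [← nsmul_eq_mul, ← Finset.card_univ]
  refine Finset.sum_le_card_nsmul _ _ _ fun k _ => ?_
  have hq : (cubeLaw T).real {x | x k ∈ Set.Ici (1 - 2 * h)} ≤ 2 * h := by
    rw [cubeLaw_real_eval k measurableSet_Ici, unitLaw_Ici (by linarith) (by linarith)]
    linarith
  refine le_trans (le_of_eq ?_) (measureReal_le_card_filter_le (E := E) (cubeLaw T) hq h1 B)
  change (Measure.pi fun _ : E => cubeLaw T).real _ = _
  congr! 3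

variable [DecidableEq T]

theorem shockLaw_real_strip_le {N w : ℕ} {h v : ℝ} (hN : 0 < N) (h0 : 0 ≤ h) (h1 : h ≤ 1)
    (hv : v ≤ w * (h ^ (Fintype.card T - 2) / N ^ 2)) :
    (shockLaw E T).real {ε | ∃ k l, k ≠ l ∧ ∃ a b : ℕ, a + w ≤ N ∧ b + w ≤ N ∧
      ∀ j, ε j ∉ strip N w h k l a b} ≤
      (Fintype.card T * Fintype.card T * ((N + 1) * (N + 1))) *
        Real.exp (-(Fintype.card E * v)) := by
  let R := {q : (T × T) × (Fin (N + 1) × Fin (N + 1)) //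
    q.1.1 ≠ q.1.2 ∧ (q.2.1 : ℕ) + w ≤ N ∧ (q.2.2 : ℕ) + w ≤ N}
  have hsub : {ε : E → T → ℝ | ∃ k l, k ≠ l ∧ ∃ a b : ℕ, a + w ≤ N ∧ b + w ≤ N ∧
      ∀ j, ε j ∉ strip N w h k l a b} ⊆
      {ε | ∃ r : R, ∀ j, ε j ∉ strip N w h r.1.1.1 r.1.1.2 r.1.2.1 r.1.2.2} := by
    rintro ε ⟨k, l, hkl, a, b, ha, hb, hj⟩
    exact ⟨⟨((k, l), (⟨a, by omega⟩, ⟨b, by omega⟩)), hkl, ha, hb⟩, hj⟩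
  refine (measureReal_mono hsub).trans ?_
  refine (measureReal_exists_forall_notMem_le (R := R) (cubeLaw T)
    (fun r => measurableSet_strip _ _ _ _ _ _ _) (v := v) fun r => ?_).trans ?_
  · rw [cubeLaw_real_strip hN h0 h1 r.2.1 r.2.2.1 r.2.2.2]
    exact hv
  · refine mul_le_mul_of_nonneg_right ?_ (Real.exp_pos _).le
    have := Fintype.card_subtype_le fun q : (T × T) × (Fin (N + 1) × Fin (N + 1)) =>
      q.1.1 ≠ q.1.2 ∧ (q.2.1 : ℕ) + w ≤ N ∧ (q.2.2 : ℕ) + w ≤ N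
    simp only [Fintype.card_prod, Fintype.card_fin] at this
    exact_mod_cast this

theorem shockLaw_real_grid_le {n : ℕ} {v : ℝ} (hn : 0 < n) :
    (shockLaw E T).real {ε | ∃ lo hi : T → Fin (n + 1), (∀ i, lo i ≤ hi i) ∧
      v ≤ ∏ i, (((hi i : ℕ) : ℝ) / n - ((lo i : ℕ) : ℝ) / n) ∧
      ∀ j, ε j ∉ Set.univ.pi fun i => Set.Ioo (((lo i : ℕ) : ℝ) / n) (((hi i : ℕ) : ℝ) / n)} ≤
      ((n + 1) ^ Fintype.card T * (n + 1) ^ Fintype.card T) *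
        Real.exp (-(Fintype.card E * v)) := by
  have hn' : (0 : ℝ) < n := by exact_mod_cast hn
  let R := {q : (T → Fin (n + 1)) × (T → Fin (n + 1)) // (∀ i, q.1 i ≤ q.2 i) ∧
    v ≤ ∏ i, (((q.2 i : ℕ) : ℝ) / n - ((q.1 i : ℕ) : ℝ) / n)}
  have hsub : {ε : E → T → ℝ | ∃ lo hi : T → Fin (n + 1), (∀ i, lo i ≤ hi i) ∧
      v ≤ ∏ i, (((hi i : ℕ) : ℝ) / n - ((lo i : ℕ) : ℝ) / n) ∧
      ∀ j, ε j ∉ Set.univ.pi fun i => Set.Ioo (((lo i : ℕ) : ℝ) / n) (((hi i : ℕ) : ℝ) / n)} ⊆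
      {ε | ∃ r : R, ∀ j, ε j ∉ Set.univ.pi fun i =>
        Set.Ioo (((r.1.1 i : ℕ) : ℝ) / n) (((r.1.2 i : ℕ) : ℝ) / n)} := by
    rintro ε ⟨lo, hi, hle, hvol, hj⟩
    exact ⟨⟨(lo, hi), hle, hvol⟩, hj⟩
  refine (measureReal_mono hsub).trans ?_
  have : Fintype R := Fintype.ofFinite R
  refine (measureReal_exists_forall_notMem_le (R := R) (cubeLaw T)
    (fun r => MeasurableSet.univ_pi fun i => measurableSet_Ioo) (v := v) fun r => ?_).trans ?_
  · rw [cubeLaw_real_box (fun i => by positivity) (fun i => ?_) fun i => ?_]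
    · exact r.2.2
    · have : ((r.1.1 i : ℕ) : ℝ) ≤ (r.1.2 i : ℕ) := by exact_mod_cast r.2.1 i
      gcongr
    · rw [div_le_one hn']
      exact_mod_cast Nat.lt_succ_iff.1 (r.1.2 i).2
  · refine mul_le_mul_of_nonneg_right ?_ (Real.exp_pos _).le
    have := Fintype.card_le_of_injective (fun r : R => r.1) Subtype.val_injective
    simp only [Fintype.card_prod, Fintype.card_fin, Fintype.card_pi, Finset.prod_const,
      Finset.card_univ] at this
    exact_mod_cast this

theorem shockLaw_real_not_isTypical_le {B N w n : ℕ} {h v v' : ℝ} (h0 : 0 ≤ 2 * h) (h1 : 2 * h ≤ 1)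
    (hN : 0 < N) (hn : 0 < n) (hv : v ≤ w * (h ^ (Fintype.card T - 2) / N ^ 2)) :
    (shockLaw E T).real {ε | ¬ IsTypical B N w n h v' ε} ≤
      Fintype.card T * (2 ^ Fintype.card E * (2 * h) ^ B) +
      (Fintype.card T * Fintype.card T * ((N + 1) * (N + 1))) * Real.exp (-(Fintype.card E * v)) +
      ((n + 1) ^ Fintype.card T * (n + 1) ^ Fintype.card T) *
        Real.exp (-(Fintype.card E * v')) := by
  have h3 : (shockLaw E T).real {ε | ¬ ∀ j k, ε j k ∈ Set.Icc (0 : ℝ) 1} = 0 := by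
    rw [Measure.real, ae_iff.1 (ae_shockLaw_mem_Icc E T), ENNReal.toReal_zero]
  refine le_trans (measureReal_mono (s₂ := {ε | ¬ ∀ j k, ε j k ∈ Set.Icc (0 : ℝ) 1} ∪
    {ε | ∃ k, B ≤ (Finset.univ.filter fun j => 1 - 2 * h ≤ ε j k).card} ∪
    {ε | ∃ k l, k ≠ l ∧ ∃ a b : ℕ, a + w ≤ N ∧ b + w ≤ N ∧ ∀ j, ε j ∉ strip N w h k l a b} ∪
    {ε | ∃ lo hi : T → Fin (n + 1), (∀ i, lo i ≤ hi i) ∧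
      v' ≤ ∏ i, (((hi i : ℕ) : ℝ) / n - ((lo i : ℕ) : ℝ) / n) ∧
      ∀ j, ε j ∉ Set.univ.pi fun i => Set.Ioo (((lo i : ℕ) : ℝ) / n) (((hi i : ℕ) : ℝ) / n)})
    fun ε hε => ?_) ?_
  · by_contra hcon
    simp only [Set.mem_union, Set.mem_ofPred_eq, not_or, not_not] at hcon
    refine hε ⟨hcon.1.1.1, fun k => ?_, fun k l hkl a b ha hb => ?_, fun lo hi hle hvol => ?_⟩
    · by_contra! hk
      exact hcon.1.1.2 ⟨k, hk⟩
    · by_contra! hj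
      exact hcon.1.2 ⟨k, l, hkl, a, b, ha, hb, hj⟩
    · by_contra! hj
      refine hcon.2 ⟨lo, hi, hle, hvol, fun j hmem => ?_⟩
      obtain ⟨i, hi⟩ := hj j
      exact hi (hmem i (Set.mem_univ i))
  · refine (measureReal_union_le _ _).trans (add_le_add ((measureReal_union_le _ _).trans
      (add_le_add ((measureReal_union_le _ _).trans ?_) (shockLaw_real_strip_le hN (by linarith)
      (by linarith) hv))) (shockLaw_real_grid_le hn))
    rw [h3, zero_add]
    exact shockLaw_real_upper_le h0 h1 B

end TypicalProbability

/-! ### The expected gap. -/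

/-- An elementary substitute for Jensen's inequality: if the mean of `y` is at most `z`, integration
bounds the mean of `y ^ s` by `2 * z ^ s`. -/
theorem rpow_le_add_mul {y z s : ℝ} (hy : 0 ≤ y) (hz : 0 < z) (hs0 : 0 ≤ s) (hs1 : s ≤ 1) :
    y ^ s ≤ z ^ s + y * z ^ (s - 1) := by
  rcases le_total y z with h | h
  · have := Real.rpow_le_rpow hy h hs0
    have : 0 ≤ y * z ^ (s - 1) := mul_nonneg hy (Real.rpow_nonneg hz.le _)
    linarith
  · have hy' : 0 < y := hz.trans_le h
    have h1 : y ^ s = y * y ^ (s - 1) := by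
      rw [Real.rpow_sub_one hy'.ne']; field_simp
    have h2 : y ^ (s - 1) ≤ z ^ (s - 1) := Real.rpow_le_rpow_of_nonpos hz h (by linarith)
    have := mul_le_mul_of_nonneg_left h2 hy
    have := Real.rpow_nonneg hz.le s
    linarith

theorem integrable_meanGap {L E T : Type*} [Fintype L] [Fintype E] [Fintype T] [DecidableEq T]
    (τ : L → T) : Integrable (fun ε : E → T → ℝ => meanGap τ ε) (shockLaw E T) := by
  refine Integrable.of_bound (C := 1) (measurable_meanGap τ).aestronglyMeasurable
    (ae_of_all _ fun ε => ?_)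
  rw [Real.norm_of_nonneg (meanGap_nonneg τ ε)]
  exact meanGap_le zero_le_one fun k => priceGap_le_one τ ε k

/-- The expected gap in terms of the mesh parameters. -/
theorem integral_meanGap_le_of_params {L E T : Type*} [Fintype L] [Fintype E] [Fintype T]
    [DecidableEq T] [Nonempty T] {τ : L → T} {B N w n : ℕ} {h v g z q : ℝ}
    (hcard : Fintype.card L < Fintype.card E) (hτ : Function.Surjective τ)
    (hB : ∀ k, B ≤ (Finset.univ.filter fun i => τ i = k).card) (hN : 0 < N)
    (hNh : 2 ≤ N * h) (hw : (w : ℝ) + 1 ≤ N * h) (hn : 0 < n) (hv : 0 ≤ v) (hg : 4 / (N : ℝ) ≤ g)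
    (hng : 4 / (n : ℝ) ≤ g)
    (hq : (shockLaw E T).real {ε | ¬ IsTypical B N w n h v ε} ≤ q)
    (hz : Fintype.card E / ((Fintype.card E : ℝ) - Fintype.card L) *
      (1 + Real.log n) ^ Fintype.card T ≤ z) :
    ∫ ε : E → T → ℝ, meanGap τ ε ∂shockLaw E T ≤ 2 * g + 2 ^ Fintype.card T * v *
      (2 * z ^ (((Fintype.card T : ℝ) - 1) / Fintype.card T)) + q := by
  have hn' : (0 : ℝ) < n := by exact_mod_cast hn
  have hn1 : (1 : ℝ) ≤ n := by exact_mod_cast hn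
  have hg0 : 0 < g := lt_of_lt_of_le (by positivity) hng
  have hE : 0 < Fintype.card E := by omega
  have hE' : (0 : ℝ) < Fintype.card E := by exact_mod_cast hE
  have hm : (0 : ℝ) < (Fintype.card E : ℝ) - Fintype.card L := by
    rw [sub_pos]; exact_mod_cast hcard
  have hlog := Real.log_nonneg hn1
  have hz0 : 0 < z := lt_of_lt_of_le (by positivity) hz
  have hK : (1 : ℝ) ≤ Fintype.card T := by exact_mod_cast (Fintype.card_pos : 0 < Fintype.card T)
  set m : ℝ := (Fintype.card E : ℝ) - Fintype.card L with hmdef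
  set s : ℝ := ((Fintype.card T : ℝ) - 1) / Fintype.card T with hs
  have hs0 : 0 ≤ s := div_nonneg (by linarith) (by linarith)
  have hs1 : s ≤ 1 := by rw [hs, div_le_one (by linarith)]; linarith
  set ν := shockLaw E T
  -- A measurable hull of the same measure spares a proof that typicality is measurable.
  set bad : Set (E → T → ℝ) := toMeasurable ν {ε | ¬ IsTypical B N w n h v ε} with hbad
  have hR : ∀ ε : E → T → ℝ, 0 ≤ recipVolume (n : ℝ)⁻¹ ε := fun ε => Finset.sum_nonneg fun j _ =>
    Finset.prod_nonneg fun k _ => inv_nonneg.2 ((inv_nonneg.2 hn'.le).trans (le_max_right _ _))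
  have hzs : 0 ≤ z ^ (s - 1) := Real.rpow_nonneg hz0.le _
  set F : (E → T → ℝ) → ℝ := fun ε => 2 * g + 2 ^ Fintype.card T * v *
    (z ^ s + recipVolume (n : ℝ)⁻¹ ε / m * z ^ (s - 1)) with hF
  have hF0 : ∀ ε, 0 ≤ F ε := fun ε => by
    have := hR ε
    have := Real.rpow_nonneg hz0.le s
    positivity
  have hRint : Integrable (fun ε : E → T → ℝ => recipVolume (n : ℝ)⁻¹ ε) ν :=
    integrable_recipVolume (inv_pos.2 hn')
  have hFint : Integrable F ν :=
    (integrable_const _).add (((integrable_const _).add ((hRint.div_const _).mul_const _)).const_mul _)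
  have hind : Integrable (bad.indicator fun _ => (1 : ℝ)) ν :=
    (integrable_const _).indicator (measurableSet_toMeasurable _ _)
  have hpt : ∀ ε : E → T → ℝ, meanGap τ ε ≤ F ε + bad.indicator (fun _ => (1 : ℝ)) ε := by
    intro ε
    by_cases hε : IsTypical B N w n h v ε
    · have h1 : meanGap τ ε ≤ F ε := meanGap_le (hF0 ε) fun k =>
        (hε.priceGap_le hcard hτ hB hN hNh hw hn hv hg hng k).trans (by
          refine add_le_add le_rfl (mul_le_mul_of_nonneg_left ?_ (by positivity))
          exact rpow_le_add_mul (div_nonneg (hR ε) hm.le) hz0 hs0 hs1)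
      have h2 : 0 ≤ bad.indicator (fun _ => (1 : ℝ)) ε :=
        Set.indicator_nonneg (fun _ _ => zero_le_one) _
      linarith
    · rw [Set.indicator_of_mem (subset_toMeasurable ν _ hε)]
      have := meanGap_le zero_le_one fun k => priceGap_le_one τ ε k
      linarith [hF0 ε]
  have hbadle : ν.real bad ≤ q := by
    rw [Measure.real, hbad, measure_toMeasurable]; exact hq
  have hIR : (∫ ε, recipVolume (n : ℝ)⁻¹ ε ∂ν) / m ≤ z := by
    rw [integral_recipVolume (inv_pos.2 hn') (inv_le_one_of_one_le₀ hn1), inv_inv]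
    refine le_trans (le_of_eq ?_) hz
    ring
  have hzz : z * z ^ (s - 1) = z ^ s := by
    rw [Real.rpow_sub_one hz0.ne']; field_simp
  calc ∫ ε : E → T → ℝ, meanGap τ ε ∂ν
      ≤ ∫ ε, (F ε + bad.indicator (fun _ => (1 : ℝ)) ε) ∂ν :=
        integral_mono (integrable_meanGap τ) (hFint.add hind) hpt
    _ = (2 * g + 2 ^ Fintype.card T * v *
          (z ^ s + (∫ ε, recipVolume (n : ℝ)⁻¹ ε ∂ν) / m * z ^ (s - 1))) + ν.real bad := by
        have hF' : F = fun ε => (2 * g + 2 ^ Fintype.card T * v * z ^ s) +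
            2 ^ Fintype.card T * v * z ^ (s - 1) / m * recipVolume (n : ℝ)⁻¹ ε := by
          rw [hF]; funext ε; ring
        rw [integral_add hFint hind, integral_indicator_const _ (measurableSet_toMeasurable _ _),
          hF', integral_add (integrable_const _) (hRint.const_mul _), integral_const_mul,
          integral_const, probReal_univ, smul_eq_mul, smul_eq_mul]
        ring
    _ ≤ _ := by
        have : (∫ ε, recipVolume (n : ℝ)⁻¹ ε ∂ν) / m * z ^ (s - 1) ≤ z ^ s := by
          rw [← hzz]
          exact mul_le_mul_of_nonneg_right hIR hzs
        have h2 : 2 ^ Fintype.card T * v *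
          (z ^ s + (∫ ε, recipVolume (n : ℝ)⁻¹ ε ∂ν) / m * z ^ (s - 1)) ≤
          2 ^ Fintype.card T * v * (2 * z ^ s) := by
          gcongr
          linarith
        linarith

/-! ### Choice of the parameters. -/

theorem one_le_log_of_three_le {n : ℕ} (hn : 3 ≤ n) : 1 ≤ Real.log n := by
  rw [Real.le_log_iff_exp_le (by positivity)]
  have : (3 : ℝ) ≤ n := by exact_mod_cast hn
  linarith [Real.exp_one_lt_d9]

theorem exp_neg_mul_log_le {n e d : ℕ} {V : ℝ} (hn : 0 < n) (he : n ≤ 2 * e) (hV : 2 * (d : ℝ) ≤ V) :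
    Real.exp (-(e * (V * (Real.log n / n)))) ≤ ((n : ℝ) ^ d)⁻¹ := by
  have hn' : (0 : ℝ) < n := by exact_mod_cast hn
  have hlog : 0 ≤ Real.log n := Real.log_natCast_nonneg n
  have he' : (n : ℝ) ≤ 2 * e := by exact_mod_cast he
  have h1 : ((n : ℝ) ^ d)⁻¹ = Real.exp (-(d * Real.log n)) := by
    rw [Real.exp_neg, Real.exp_nat_mul, Real.exp_log hn']
  rw [h1]
  refine Real.exp_le_exp.2 (neg_le_neg ?_)
  have h2 : (d : ℝ) ≤ e * V / n := by
    rw [le_div_iff₀ hn']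
    have hd : (0 : ℝ) ≤ d := Nat.cast_nonneg d
    nlinarith
  calc (d : ℝ) * Real.log n ≤ e * V / n * Real.log n := mul_le_mul_of_nonneg_right h2 hlog
    _ = _ := by ring

/-- The failure probabilities of the three kinds of regularity add up to `O (1 / n)`. -/
theorem failure_le {K n e N B : ℕ} {c κ V : ℝ} (hn : 2 ≤ n) (he : e ≤ n) (he2 : n ≤ 2 * e)
    (hNn : N ≤ n) (hκ0 : 0 < κ) (hκ1 : κ ≤ 1) (hκ : κ ^ c = 1 / 4) (hB : c * n ≤ B)
    (hV : 8 * (K : ℝ) + 2 ≤ V) :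
    K * (2 ^ e * κ ^ B) + (K * K * ((N + 1) * (N + 1))) *
        Real.exp (-(e * (10 * (Real.log n / n)))) +
      ((n + 1) ^ K * (n + 1) ^ K) * Real.exp (-(e * (V * (Real.log n / n)))) ≤
      (K + K * K + 1) / (n : ℝ) := by
  have hn' : (0 : ℝ) < n := by positivity
  have hn2 : (2 : ℝ) ≤ n := by exact_mod_cast hn
  have hsq : (n : ℝ) + 1 ≤ n ^ 2 := by nlinarith
  have h1 : (2 : ℝ) ^ e * κ ^ B ≤ 1 / n := by
    have ha : κ ^ B ≤ (1 / 4) ^ n := by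
      rw [← Real.rpow_natCast κ B, ← hκ, ← Real.rpow_natCast (κ ^ c) n, ← Real.rpow_mul hκ0.le]
      exact Real.rpow_le_rpow_of_exponent_ge hκ0 hκ1 hB
    have hb : (2 : ℝ) ^ e ≤ 2 ^ n := pow_le_pow_right₀ one_le_two he
    have hc : (n : ℝ) ≤ 2 ^ n := by exact_mod_cast Nat.lt_two_pow_self.le
    calc (2 : ℝ) ^ e * κ ^ B ≤ 2 ^ n * (1 / 4) ^ n := by gcongr
      _ = 1 / 2 ^ n := by
        rw [← mul_pow, ← one_div_pow]; norm_num
      _ ≤ 1 / n := by gcongr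
  have h2 : ((N : ℝ) + 1) * (N + 1) * Real.exp (-(e * (10 * (Real.log n / n)))) ≤ 1 / n := by
    -- At most `n ^ 4` positions per pair of types, so the power `5` leaves `1 / n`; the constant
    -- doubles to `10` because only `n ≤ 2 * e` is known. Likewise `V` is twice `4 * K + 1` for the
    -- grid boxes.
    have ha := exp_neg_mul_log_le (V := 10) (d := 5) (by omega) he2 (by norm_num)
    have hb : (N : ℝ) + 1 ≤ n ^ 2 := by
      have : (N : ℝ) ≤ n := by exact_mod_cast hNn
      linarith
    calc _ ≤ (n : ℝ) ^ 2 * n ^ 2 * ((n : ℝ) ^ 5)⁻¹ := by gcongr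
      _ = 1 / n := by field_simp
  have h3 : ((n : ℝ) + 1) ^ K * (n + 1) ^ K * Real.exp (-(e * (V * (Real.log n / n)))) ≤ 1 / n := by
    have ha := exp_neg_mul_log_le (V := V) (d := 4 * K + 1) (by omega) he2 (by push_cast; linarith)
    calc _ ≤ ((n : ℝ) ^ 2) ^ K * (n ^ 2) ^ K * ((n : ℝ) ^ (4 * K + 1))⁻¹ := by gcongr
      _ = (n : ℝ) ^ (4 * K) * ((n : ℝ) ^ (4 * K + 1))⁻¹ := by
        rw [← pow_mul, ← pow_add]; congr 2; ring
      _ = 1 / n := by rw [pow_succ]; field_simp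
  have hK : (0 : ℝ) ≤ K := Nat.cast_nonneg K
  calc _ ≤ K * (1 / (n : ℝ)) + K * K * (1 / n) + 1 / n := by
        rw [mul_assoc ((K : ℝ) * K)]
        gcongr
    _ = _ := by ring

theorem inv_eq_mul_rpow {n m K : ℝ} (hn : 0 < n) (hm : 0 < m) (hK : 0 < K) :
    1 / n * (n / m) ^ ((K - 1) / K) = 1 / (n ^ (1 / K) * m ^ ((K - 1) / K)) := by
  have h1 : n = n ^ (1 / K) * n ^ ((K - 1) / K) := by
    rw [← Real.rpow_add hn]
    have : 1 / K + (K - 1) / K = 1 := by field_simp; ring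
    rw [this, Real.rpow_one]
  have h2 := Real.rpow_pos_of_pos hn (1 / K)
  have h3 := Real.rpow_pos_of_pos hn ((K - 1) / K)
  have h4 := Real.rpow_pos_of_pos hm ((K - 1) / K)
  rw [Real.div_rpow hn.le hm.le]
  have h5 : 1 / n = 1 / (n ^ (1 / K) * n ^ ((K - 1) / K)) := by rw [← h1]
  rw [h5]
  field_simp

/-- The choice of the mesh of the diagonal strips. -/
theorem exists_mesh {K n : ℕ} {h x : ℝ} (hK : 2 ≤ K) (hh0 : 0 < h) (hh1 : h ≤ 1) (hx : 0 < x)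
    (hsmall : 100 / h ^ (K - 1) * x ≤ h) (hn : 4 ≤ 100 / h ^ (K - 1) * x * n) :
    ∃ N w : ℕ, 0 < N ∧ N ≤ n ∧ 4 / (N : ℝ) ≤ 100 / h ^ (K - 1) * x ∧ 2 ≤ N * h ∧
      (w : ℝ) + 1 ≤ N * h ∧ 10 * x ≤ w * (h ^ (K - 2) / N ^ 2) := by
  have hhK : 0 < h ^ (K - 1) := by positivity
  have hCl0 : 0 < 100 / h ^ (K - 1) * x := by positivity
  obtain ⟨N, hNdef⟩ : ∃ N, N = ⌈4 / ((100 / h ^ (K - 1)) * x)⌉₊ := ⟨_, rfl⟩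
  have hN1 : 4 / ((100 / h ^ (K - 1)) * x) ≤ N := by rw [hNdef]; exact Nat.le_ceil _
  have hN2 : (N : ℝ) < 4 / ((100 / h ^ (K - 1)) * x) + 1 := by
    rw [hNdef]; exact Nat.ceil_lt_add_one (by positivity)
  have hN' : (0 : ℝ) < N := lt_of_lt_of_le (by positivity) hN1
  have hN : 0 < N := by exact_mod_cast hN'
  have hN3 : 4 ≤ N * ((100 / h ^ (K - 1)) * x) := (div_le_iff₀ hCl0).1 hN1
  have hNh : 4 ≤ N * h := hN3.trans (by gcongr)
  have hNn : N ≤ n := by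
    rw [hNdef]
    refine Nat.ceil_le.2 ?_
    rw [div_le_iff₀ hCl0]
    linarith
  -- The ceiling adds at most `h ≤ 1` to `4`. The constant `100` is what turns this `5` into `10 * x
  -- * N ≤ h ^ (K - 1) / 2`, the volume needed by a strip with `w ≥ N * h / 2` cells.
  have hN4 : N * ((100 / h ^ (K - 1)) * x) ≤ 5 := by
    have := mul_lt_mul_of_pos_right hN2 hCl0
    rw [add_mul, div_mul_cancel₀ _ hCl0.ne'] at this
    linarith
  obtain ⟨w, hwdef⟩ : ∃ w, w = ⌊(N : ℝ) * h⌋₊ - 1 := ⟨_, rfl⟩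
  have hfl : 1 ≤ ⌊(N : ℝ) * h⌋₊ := (Nat.one_le_floor_iff _).2 (by linarith)
  have hw : (w : ℝ) + 1 = ⌊(N : ℝ) * h⌋₊ := by
    rw [hwdef]; push_cast [hfl]; ring
  have hw1 : (w : ℝ) + 1 ≤ N * h := by
    rw [hw]; exact Nat.floor_le (by positivity)
  have hw2 : N * h / 2 ≤ w := by
    have := Nat.lt_floor_add_one ((N : ℝ) * h)
    linarith
  have hstrip : 10 * x ≤ w * (h ^ (K - 2) / N ^ 2) := by
    have h1 : 10 * x * N ≤ h ^ (K - 1) / 2 := by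
      have h5 : N * (100 / h ^ (K - 1) * x) = N * (100 * x) / h ^ (K - 1) := by ring
      rw [h5, div_le_iff₀ hhK] at hN4
      linarith
    have h2 : h ^ (K - 1) = h * h ^ (K - 2) := by
      rw [← pow_succ']; congr 1; omega
    have h3 : N * h / 2 * (h ^ (K - 2) / N ^ 2) ≤ w * (h ^ (K - 2) / N ^ 2) := by gcongr
    refine le_trans ?_ h3
    have h4 : N * h / 2 * (h ^ (K - 2) / N ^ 2) = h ^ (K - 1) / 2 / N := by
      rw [h2]; field_simp
    rw [h4, le_div_iff₀ hN']
    exact h1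
  exact ⟨N, w, hN, hNn, by rwa [div_le_iff₀' hN'], by linarith, hw1, hstrip⟩

set_option maxHeartbeats 400000 in
theorem exists_integral_meanGap_le (K : ℕ) (hK : 2 ≤ K) (c : ℝ) (hc : 0 < c) :
    ∃ A : ℝ, 0 ≤ A ∧ ∀ nL nE : ℕ, nL < nE → ∀ τ : Fin nL → Fin K, Function.Surjective τ →
      (∀ k, c * (nL + nE : ℕ) ≤ ((Finset.univ.filter fun i => τ i = k).card : ℝ)) →
      ∫ ε : Fin nE → Fin K → ℝ, meanGap τ ε ∂shockLaw (Fin nE) (Fin K) ≤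
        A * Real.log ((nL : ℝ) + nE) ^ (K + 1) /
          (((nL : ℝ) + nE) ^ (1 / (K : ℝ)) * ((nE : ℝ) - nL) ^ (((K : ℝ) - 1) / K)) := by
  -- The top slab has width `κ = 2 * h`: for `B ≥ c * n` this gives `κ ^ B ≤ 4 ^ (-n)`, which beats
  -- the `2 ^ n` index sets.
  set κ : ℝ := (1 / 4 : ℝ) ^ (1 / c) with hκdef
  have hκ0 : 0 < κ := by positivity
  have hκ1 : κ ≤ 1 := Real.rpow_le_one (by norm_num) (by norm_num) (by positivity)
  have hκ : κ ^ c = 1 / 4 := by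
    rw [hκdef, ← Real.rpow_mul (by norm_num), one_div_mul_cancel hc.ne', Real.rpow_one]
  set h : ℝ := κ / 2 with hh
  have hh0 : 0 < h := by positivity
  have hh1 : h ≤ 1 := by linarith
  set C₁ : ℝ := 100 / h ^ (K - 1) with hC
  have hhK : 0 < h ^ (K - 1) := by positivity
  have hC1 : 100 ≤ C₁ := by
    rw [hC, le_div_iff₀ hhK]
    have := pow_le_one₀ hh0.le hh1 (n := K - 1)
    linarith
  set V : ℝ := 8 * K + 2 with hV
  have hV0 : 0 < V := by positivity
  have hKr : (2 : ℝ) ≤ K := by exact_mod_cast hK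
  -- The first summand serves small `n`; the others pay for the mesh, the box term and the failure
  -- probability.
  refine ⟨C₁ / h + (2 * C₁ + 2 ^ K * V * (2 * 2 ^ K) + (K + K * K + 1)), by positivity, ?_⟩
  intro nL nE hlt τ hτ htypes
  have hnL : K ≤ nL := by
    simpa using Fintype.card_le_of_surjective τ hτ
  obtain ⟨n, hn⟩ : ∃ n, n = nL + nE := ⟨_, rfl⟩
  have hcast : (nL : ℝ) + nE = n := by rw [hn]; push_cast; ring
  rw [hcast]
  rw [← hn] at htypes
  have hn3 : 3 ≤ n := by omega
  have hn' : (0 : ℝ) < n := by positivity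
  set l : ℝ := Real.log n with hl
  have hl1 : 1 ≤ l := one_le_log_of_three_le hn3
  set m : ℝ := (nE : ℝ) - nL with hm
  have hm0 : 0 < m := by rw [hm, sub_pos]; exact_mod_cast hlt
  have hmn : m ≤ n := by
    rw [hm, ← hcast]
    have : (0 : ℝ) ≤ nL := Nat.cast_nonneg _
    linarith
  set s : ℝ := ((K : ℝ) - 1) / K with hs
  have hs0 : 0 ≤ s := div_nonneg (by linarith) (by linarith)
  have hs1 : s ≤ 1 := by rw [hs, div_le_one (by linarith)]; linarith
  set W : ℝ := 1 / ((n : ℝ) ^ (1 / (K : ℝ)) * m ^ s) with hW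
  have hWeq : 1 / (n : ℝ) * (n / m) ^ s = W := inv_eq_mul_rpow hn' hm0 (by linarith)
  have hW0 : 0 < W := by
    rw [← hWeq]
    have : 0 < ((n : ℝ) / m) ^ s := Real.rpow_pos_of_pos (by positivity) _
    positivity
  have hWn : 1 / (n : ℝ) ≤ W := by
    rw [← hWeq]
    refine le_mul_of_one_le_right (by positivity) (Real.one_le_rpow ?_ hs0)
    rwa [one_le_div hm0]
  have hlp : l ≤ l ^ (K + 1) := le_self_pow₀ hl1 (by omega)
  have hlp1 : 1 ≤ l ^ (K + 1) := one_le_pow₀ hl1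
  rw [mul_div_assoc, div_eq_mul_one_div (l ^ (K + 1)), ← hW]
  have hlam : l / n ≤ l ^ (K + 1) * W := by
    rw [div_eq_mul_one_div]
    exact mul_le_mul hlp hWn (by positivity) (by positivity)
  have hlam0 : 0 < l / n := by positivity
  have hCl : 4 ≤ C₁ * l := by
    have := mul_le_mul hC1 hl1 zero_le_one (by linarith)
    linarith
  -- If the mesh would be coarser than `h`, then `l / n` is bounded below and the trivial bound `1`
  -- on the gap suffices.
  rcases lt_or_ge h (C₁ * (l / n)) with hbig | hsmall
  · have h1 : ∫ ε : Fin nE → Fin K → ℝ, meanGap τ ε ∂shockLaw (Fin nE) (Fin K) ≤ 1 := by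
      have := integral_mono (integrable_meanGap (E := Fin nE) τ) (integrable_const (1 : ℝ))
        fun ε => meanGap_le zero_le_one fun k => priceGap_le_one τ ε k
      simpa using this
    have h2 : 1 ≤ C₁ / h * (l / n) := by
      rw [div_mul_eq_mul_div, one_le_div hh0]; exact hbig.le
    have h3 : C₁ / h * (l / n) ≤ C₁ / h * (l ^ (K + 1) * W) := by gcongr
    have h4 : 0 ≤ (2 * C₁ + 2 ^ K * V * (2 * 2 ^ K) + (K + K * K + 1)) * (l ^ (K + 1) * W) := by
      positivity
    linarith
  · have hCl0 : 0 < C₁ * (l / n) := by positivity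
    obtain ⟨N, w, hN, hNn, hNg, hNh, hw, hstrip⟩ := exists_mesh (n := n) hK hh0 hh1 hlam0 hsmall (by
      have : C₁ * (l / n) * n = C₁ * l := by field_simp
      rw [this]
      exact hCl)
    have hB : ∀ k, ⌈c * n⌉₊ ≤ (Finset.univ.filter fun i => τ i = k).card :=
      fun k => Nat.ceil_le.2 (htypes k)
    have hq1 := shockLaw_real_not_isTypical_le (E := Fin nE) (T := Fin K) (B := ⌈c * n⌉₊) (n := n)
      (N := N) (w := w) (v := 10 * (l / n)) (v' := V * (l / n)) (h := h) (by linarith)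
      (by linarith) hN (by omega) (by rw [Fintype.card_fin]; exact hstrip)
    rw [Fintype.card_fin, Fintype.card_fin, show 2 * h = κ by rw [hh]; ring] at hq1
    have hq := hq1.trans (failure_le (by omega) (by omega) (by omega) hNn hκ0 hκ1 hκ
      (Nat.le_ceil _) (le_refl V))
    have : Nonempty (Fin K) := ⟨⟨0, by omega⟩⟩
    have hz : (Fintype.card (Fin nE) : ℝ) / ((Fintype.card (Fin nE) : ℝ) - Fintype.card (Fin nL)) *
        (1 + Real.log n) ^ Fintype.card (Fin K) ≤ n / m * (2 * l) ^ K := by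
      simp only [Fintype.card_fin]
      have hEn : (nE : ℝ) ≤ n := by rw [← hcast]; linarith [(Nat.cast_nonneg nL : (0 : ℝ) ≤ nL)]
      have : 1 + Real.log n ≤ 2 * l := by rw [← hl]; linarith
      have h0 : 0 ≤ 1 + Real.log n := by rw [← hl]; linarith
      rw [← hm]
      gcongr
    have hng : 4 / (n : ℝ) ≤ C₁ * (l / n) := by
      rw [← mul_div_assoc]
      exact div_le_div_of_nonneg_right hCl hn'.le
    have hmain := integral_meanGap_le_of_params (by simpa using hlt) hτ hB hN hNh hw (by omega)
      (by positivity) hNg hng hq hz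
    simp only [Fintype.card_fin] at hmain
    rw [← hs] at hmain
    refine hmain.trans ?_
    -- Dropping the exponent `s ≤ 1` from the logarithms costs only powers of `l`: `K` here and one
    -- from the box volume make the final `K + 1`.
    have hzs : ((n : ℝ) / m * (2 * l) ^ K) ^ s ≤ (n / m) ^ s * (2 ^ K * l ^ K) := by
      rw [Real.mul_rpow (by positivity) (by positivity), ← mul_pow]
      refine mul_le_mul_of_nonneg_left ?_ (Real.rpow_nonneg (by positivity) _)
      calc ((2 * l) ^ K) ^ s ≤ ((2 * l) ^ K) ^ (1 : ℝ) :=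
            Real.rpow_le_rpow_of_exponent_le (one_le_pow₀ (by linarith)) hs1
        _ = _ := Real.rpow_one _
    have e1 : 2 * (C₁ * (l / n)) ≤ 2 * C₁ * (l ^ (K + 1) * W) := by
      rw [mul_assoc]; gcongr
    have e2 : 2 ^ K * (V * (l / n)) * (2 * (n / m * (2 * l) ^ K) ^ s) ≤
        2 ^ K * V * (2 * 2 ^ K) * (l ^ (K + 1) * W) := by
      calc _ ≤ 2 ^ K * (V * (l / n)) * (2 * ((n / m) ^ s * (2 ^ K * l ^ K))) := by gcongr
        _ = 2 ^ K * V * (2 * 2 ^ K) * (l ^ (K + 1) * (1 / (n : ℝ) * (n / m) ^ s)) := by ring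
        _ = _ := by rw [hWeq]
    have e3 : (K + K * K + 1) / (n : ℝ) ≤ (K + K * K + 1) * (l ^ (K + 1) * W) := by
      rw [div_eq_mul_one_div]
      exact mul_le_mul_of_nonneg_left (hWn.trans (le_mul_of_one_le_left hW0.le hlp1))
        (by positivity)
    have e4 : 0 ≤ C₁ / h * (l ^ (K + 1) * W) := by positivity
    linarith

/-! ### Transfer to the market and conclusion. -/

/-- The core size is a.e. a function of the employers' productivities. -/
theorem coreSize_integrable_and_integral_eq {L E T Ω : Type*} [Fintype L] [Fintype E] [Fintype T]
    [DecidableEq T] {mk : Market L E T (Fin 1)} (hcard : Fintype.card L < Fintype.card E)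
    (hτ : Function.Surjective mk.typeL) (hu : ∀ k, 0 ≤ mk.u k 0) [MeasurableSpace Ω]
    {P : Measure Ω} {ε : E → T → Ω → ℝ} {η : L → Fin 1 → Ω → ℝ} (h : IsUniformShocks P ε η)
    {M : Ω → Finset (L × E)} (hM : ∀ᵐ ω ∂P, IsMaxWeightMatching
      (mk.value (fun j k => ε j k ω) (fun i q => η i q ω)) (M ω)) :
    Integrable (fun ω => mk.coreSize (fun j k => ε j k ω) (fun i q => η i q ω) (M ω)) P ∧
      ∫ ω, mk.coreSize (fun j k => ε j k ω) (fun i q => η i q ω) (M ω) ∂P =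
        ∫ ε, meanGap mk.typeL ε ∂shockLaw E T := by
  have hmeas : Measurable fun ω j k => ε j k ω :=
    measurable_pi_lambda _ fun j => measurable_pi_lambda _ fun k => h.measurable_ε j k
  have hcube : ∀ᵐ ω ∂P, ∀ j k, ε j k ω ∈ Set.Icc (0 : ℝ) 1 := by
    have := ae_shockLaw_mem_Icc E T
    rw [← h.map_eq] at this
    exact ae_of_ae_map hmeas.aemeasurable this
  have hae : (fun ω => mk.coreSize (fun j k => ε j k ω) (fun i q => η i q ω) (M ω)) =ᵐ[P]
      fun ω => meanGap mk.typeL fun j k => ε j k ω := by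
    filter_upwards [hM, hcube, h.ae_pos] with ω h1 h2 h3
    exact Market.coreSize_eq_meanGap h1 hcard hτ h2 (fun i => h3 i 0) hu
  have hint : Integrable (fun ω => meanGap mk.typeL fun j k => ε j k ω) P := by
    have := integrable_meanGap (E := E) mk.typeL
    rw [← h.map_eq] at this
    exact this.comp_measurable hmeas
  refine ⟨hint.congr hae.symm, ?_⟩
  rw [integral_congr_ae hae, ← h.map_eq,
    integral_map hmeas.aemeasurable (measurable_meanGap mk.typeL).aestronglyMeasurable]

theorem Market.TypesAtLeast.surjective {nL nE K : ℕ} {mk : Market (Fin nL) (Fin nE) (Fin K) (Fin 1)}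
    {c : ℝ} (h : mk.TypesAtLeast c) (hc : 0 < c) (hlt : nL < nE) :
    Function.Surjective mk.typeL := by
  intro k
  have h1 := h.1 k
  simp only [Fintype.card_fin] at h1
  have h2 : (0 : ℝ) < (nL + nE : ℕ) := by
    have : 0 < nL + nE := by omega
    exact_mod_cast this
  have h3 : (0 : ℝ) < ((Finset.univ.filter fun i => mk.typeL i = k).card : ℝ) :=
    lt_of_lt_of_le (mul_pos hc h2) h1
  obtain ⟨i, hi⟩ := Finset.card_pos.1 (by exact_mod_cast h3)
  exact ⟨i, (Finset.mem_filter.1 hi).2⟩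

theorem rate_le_of_mul_le {n m K b : ℝ} (hn : 0 < n) (hK : 1 ≤ K) (hb : 0 < b) (hm : 0 < m)
    (hbm : b * n ≤ m) :
    1 / (n ^ (1 / K) * m ^ ((K - 1) / K)) ≤ (1 / b) ^ ((K - 1) / K) / n := by
  rw [← inv_eq_mul_rpow hn hm (by linarith), one_div_mul_eq_div]
  have hs0 : 0 ≤ (K - 1) / K := div_nonneg (by linarith) (by linarith)
  have : n / m ≤ 1 / b := by
    rw [div_le_div_iff₀ hm hb]; linarith
  gcongr

theorem theorem2 (K : ℕ) (hK : 2 ≤ K) (c : ℝ) (hc : 0 < c) :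
    (∃ (A : ℝ) (p : ℕ), ∀ (nL nE : ℕ), nL < nE →
      ∀ (mk : Market (Fin nL) (Fin nE) (Fin K) (Fin 1)),
      mk.TypesAtLeast c → (∀ k, 0 ≤ mk.u k 0) →
      ∀ (Ω : Type*) [MeasurableSpace Ω] (P : Measure Ω) [IsProbabilityMeasure P]
        (ε : Fin nE → Fin K → Ω → ℝ) (η : Fin nL → Fin 1 → Ω → ℝ), IsUniformShocks P ε η →
      ∀ (M : Ω → Finset (Fin nL × Fin nE)),
      (∀ᵐ ω ∂P, IsMaxWeightMatching
        (mk.value (fun j k => ε j k ω) (fun i q => η i q ω)) (M ω)) →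
      Integrable (fun ω => mk.coreSize (fun j k => ε j k ω) (fun i q => η i q ω) (M ω)) P ∧
      ∫ ω, mk.coreSize (fun j k => ε j k ω) (fun i q => η i q ω) (M ω) ∂P ≤
        A * Real.log ((nL : ℝ) + nE) ^ p /
          (((nL : ℝ) + nE) ^ (1 / (K : ℝ)) * ((nE : ℝ) - nL) ^ (((K : ℝ) - 1) / K))) ∧
    (∀ b : ℝ, 0 < b → ∃ (A : ℝ) (p : ℕ), ∀ (nL nE : ℕ), nL < nE →
      b * ((nL : ℝ) + nE) ≤ (nE : ℝ) - nL →
      ∀ (mk : Market (Fin nL) (Fin nE) (Fin K) (Fin 1)),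
      mk.TypesAtLeast c → (∀ k, 0 ≤ mk.u k 0) →
      ∀ (Ω : Type*) [MeasurableSpace Ω] (P : Measure Ω) [IsProbabilityMeasure P]
        (ε : Fin nE → Fin K → Ω → ℝ) (η : Fin nL → Fin 1 → Ω → ℝ), IsUniformShocks P ε η →
      ∀ (M : Ω → Finset (Fin nL × Fin nE)),
      (∀ᵐ ω ∂P, IsMaxWeightMatching
        (mk.value (fun j k => ε j k ω) (fun i q => η i q ω)) (M ω)) →
      Integrable (fun ω => mk.coreSize (fun j k => ε j k ω) (fun i q => η i q ω) (M ω)) P ∧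
      ∫ ω, mk.coreSize (fun j k => ε j k ω) (fun i q => η i q ω) (M ω) ∂P ≤
        A * Real.log ((nL : ℝ) + nE) ^ p / ((nL : ℝ) + nE)) := by 
  obtain ⟨A, hA, h⟩ := exists_integral_meanGap_le K hK c hc
  have hbound : ∀ (nL nE : ℕ), nL < nE →
      ∀ (mk : Market (Fin nL) (Fin nE) (Fin K) (Fin 1)), mk.TypesAtLeast c →
      ∫ ε, meanGap mk.typeL ε ∂shockLaw (Fin nE) (Fin K) ≤
        A * Real.log ((nL : ℝ) + nE) ^ (K + 1) /
          (((nL : ℝ) + nE) ^ (1 / (K : ℝ)) * ((nE : ℝ) - nL) ^ (((K : ℝ) - 1) / K)) := by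
    intro nL nE hlt mk htypes
    refine h nL nE hlt mk.typeL (htypes.surjective hc hlt) fun k => ?_
    simpa only [Fintype.card_fin] using htypes.1 k
  refine ⟨⟨A, K + 1, ?_⟩, fun b hb => ⟨A * (1 / b) ^ (((K : ℝ) - 1) / K), K + 1, ?_⟩⟩
  · intro nL nE hlt mk htypes hu Ω _ P _ ε η hP M hM
    obtain ⟨h1, h2⟩ := coreSize_integrable_and_integral_eq (by simpa using hlt)
      (htypes.surjective hc hlt) hu hP hM
    exact ⟨h1, h2 ▸ hbound nL nE hlt mk htypes⟩
  · intro nL nE hlt hbm mk htypes hu Ω _ P _ ε η hP M hM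
    obtain ⟨h1, h2⟩ := coreSize_integrable_and_integral_eq (by simpa using hlt)
      (htypes.surjective hc hlt) hu hP hM
    refine ⟨h1, h2 ▸ (hbound nL nE hlt mk htypes).trans ?_⟩
    have hm : (0 : ℝ) < (nE : ℝ) - nL := by rw [sub_pos]; exact_mod_cast hlt
    have hn : (0 : ℝ) < (nL : ℝ) + nE := by
      have : (0 : ℝ) ≤ nL := Nat.cast_nonneg _
      linarith
    have hn1 : (1 : ℝ) ≤ (nL : ℝ) + nE := by
      have : 1 ≤ nL + nE := by omega
      exact_mod_cast this
    have hlog : 0 ≤ Real.log ((nL : ℝ) + nE) := Real.log_nonneg hn1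
    have hK1 : (1 : ℝ) ≤ K := by exact_mod_cast (by omega : 1 ≤ K)
    have hrate := rate_le_of_mul_le hn hK1 hb hm hbm
    rw [div_eq_mul_one_div]
    refine (mul_le_mul_of_nonneg_left hrate (by positivity)).trans (le_of_eq ?_)
    ring
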